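/- Let $F$ be a field, let $n\ge 3$, and let $Q$ be a non-degenerate hyperbolic quadratic form (Witt index $n$) on a $2n$-dimensional vector space $W$ over $F$. The building $\Delta$ of type $D_n(F)$ has as objects the totally singular subspaces of $W$ of dimension $1,\dots,n-2$ or $n$; two objects are incident if one contains the other, or if both have dimension $n$ and they meet in an $(n-1)$-space. A flag is a (possibly empty) set of pairwise incident objects. The geometry $\Gamma$ of type $D_{n,n-2}(F)$ has as points the totally singular $(n-2)$-spaces of $W$, and as lines the sets $\{P : L_0\subseteq P\subseteq L_-\cap L_+\}$, where $L_-,L_+$ are totally singular $n$-spaces meeting in an $(n-1)$-space and $L_0\subseteq L_-\cap L_+$ is an $(n-3)$-space. The geometry $A_{m,l}(F)$ has as points the $l$-dimensional subspaces of $F^{m+1}$, and as lines the sets $\{B : A\subseteq B\subseteq C\}$ with $A\subseteq C$, $\dim A=l-1$, $\dim C=l+1$. A subspace of $\Gamma$ is a set $S$ of points that contains every line meeting it in at least two points; it is regarded as a geometry whose lines are the lines of $\Gamma$ contained in $S$. A set of points of $\Gamma$ is called parabolic if it is the set of all points incident with every object of some flag of $\Delta$. Theorem. Let $S$ be a subspace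 of $\Gamma$ isomorphic, as a point-line geometry, to $A_{m,l}(F)$, where $\min\{l,m+1-l\}\ge 2$. Then $S$ is parabolic. Moreover $l\in\{2,m-1\}$, and if $m\ge 4$, then all points of $S$ are contained in a common totally singular $n$-space of $W$. -/

import Mathlib

open Module

universe u v

/-- A point-line geometry with point set `P`: a family of sets of points, the lines. -/
structure PointLineGeometry (P : Type u) where
  lines : Set (Set P)

namespace PointLineGeometry

/-- A set `S` of points is a subspace if every line that meets `S` in at least two points is
contained in `S`. -/
def IsSubspace {P : Type u} (G : PointLineGeometry P) (S : Set P) : Prop :=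
  ∀ L ∈ G.lines, (L ∩ S).Nontrivial → L ⊆ S

/-- The geometry induced on a set `S` of points: its lines are the lines of `G` contained in
`S`. -/
def induced {P : Type u} (G : PointLineGeometry P) (S : Set P) : PointLineGeometry S where
  lines := {L | Subtype.val '' L ∈ G.lines}

/-- Two point-line geometries are isomorphic if there is a bijection between their points that
maps the lines of the first exactly onto the lines of the second. -/
def Isomorphic {P : Type u} {P' : Type v} (G : PointLineGeometry P)
    (G' : PointLineGeometry P') : Prop :=
  ∃ e : P ≃ P', ∀ L : Set P, L ∈ G.lines ↔ e '' L ∈ G'.lines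

end PointLineGeometry

/-- The `j`-Grassmannian of a vector space `V`: the points are the linear `j`-spaces `B` of `V`,
the lines are the sets `{B | A ≤ B ≤ C}` for `A ≤ C`, `dim A = j - 1`, `dim C = j + 1`. -/
def projGrassmannian (F : Type u) [Field F] (V : Type v) [AddCommGroup V] [Module F V] (j : ℕ) :
    PointLineGeometry {B : Submodule F V // finrank F B = j} where
  lines := {L | ∃ A C : Submodule F V, A ≤ C ∧ finrank F A + 1 = j ∧ finrank F C = j + 1 ∧
    L = {B | A ≤ B.1 ∧ B.1 ≤ C}}

/-- The geometry `A_{m,j}(F)`. -/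
def geomA (F : Type u) [Field F] (m j : ℕ) :
    PointLineGeometry {B : Submodule F (Fin (m + 1) → F) // finrank F B = j} :=
  projGrassmannian F (Fin (m + 1) → F) j

section Polar

variable {F : Type u} [Field F] {W : Type v} [AddCommGroup W] [Module F W]

/-- `U` is totally singular for the quadratic form `Q`. -/
def IsTotSingular (Q : QuadraticForm F W) (U : Submodule F W) : Prop :=
  ∀ x ∈ U, Q x = 0

/-- `Q` is a non-degenerate hyperbolic quadratic form of Witt index `n`, that is, `W` has
dimension `2 n`, the polar form of `Q` is non-degenerate, and there is a totally singular
`n`-space. This makes sense in every characteristic. -/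
structure IsHyperbolicForm (Q : QuadraticForm F W) (n : ℕ) : Prop where
  finiteDimensional : FiniteDimensional F W
  finrank_eq : finrank F W = 2 * n
  nondegenerate : (QuadraticMap.polarBilin Q).Nondegenerate
  exists_totSingular : ∃ U : Submodule F W, IsTotSingular Q U ∧ finrank F U = n

/-- The objects of the building of type `D_n`: the totally singular subspaces of dimension
`1, 2, …, n - 2` or `n`. -/
def IsObjectD (Q : QuadraticForm F W) (n : ℕ) (X : Submodule F W) : Prop :=
  IsTotSingular Q X ∧ ((1 ≤ finrank F X ∧ finrank F X + 2 ≤ n) ∨ finrank F X = n)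

/-- Incidence of objects of the building of type `D_n`: inclusion, and two totally singular
`n`-spaces are also incident if they meet in codimension one. -/
def IncidentD (n : ℕ) (X Y : Submodule F W) : Prop :=
  X ≤ Y ∨ Y ≤ X ∨
    (finrank F X = n ∧ finrank F Y = n ∧ finrank F (X ⊓ Y : Submodule F W) + 1 = n)

/-- A flag of the building of type `D_n`: a set (possibly empty) of pairwise incident objects. -/
def IsFlagD (Q : QuadraticForm F W) (n : ℕ) (Fl : Set (Submodule F W)) : Prop :=
  (∀ X ∈ Fl, IsObjectD Q n X) ∧ Fl.Pairwise (IncidentD n)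

/-- The points of the geometry of type `D_{n,n-2}`: the totally singular `(n - 2)`-spaces. -/
abbrev PointD (Q : QuadraticForm F W) (n : ℕ) : Type v :=
  {P : Submodule F W // IsTotSingular Q P ∧ finrank F P + 2 = n}

/-- The geometry of type `D_{n,n-2}`. Its lines are the sets `{P | L₀ ≤ P ≤ L₁ ⊓ L₂}`, where
`L₁`, `L₂` are totally singular `n`-spaces meeting in codimension one (hence of different types)
and `L₀` is an `(n - 3)`-space contained in both. For `n = 3` this means `L₀ = 0`. -/
def geomD (Q : QuadraticForm F W) (n : ℕ) : PointLineGeometry (PointD Q n) where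
  lines := {L | ∃ L₀ L₁ L₂ : Submodule F W,
    IsTotSingular Q L₁ ∧ finrank F L₁ = n ∧ IsTotSingular Q L₂ ∧ finrank F L₂ = n ∧
    finrank F (L₁ ⊓ L₂ : Submodule F W) + 1 = n ∧
    finrank F L₀ + 3 = n ∧ L₀ ≤ L₁ ∧ L₀ ≤ L₂ ∧
    L = {P | L₀ ≤ P.1 ∧ P.1 ≤ L₁ ⊓ L₂}}

/-- A set of points of the geometry of type `D_{n,n-2}` is parabolic if it is the shadow of a
flag (of the residue of that flag), that is, the set of all points incident with every object of
the flag. -/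
def IsParabolicD (Q : QuadraticForm F W) (n : ℕ) (S : Set (PointD Q n)) : Prop :=
  ∃ Fl : Set (Submodule F W), IsFlagD Q n Fl ∧ S = {P | ∀ X ∈ Fl, IncidentD n P.1 X}

end Polar

/-! Read the isomorphism backwards, as a map `f` from the `l`-spaces of `V = F^(m+1)` to totally
singular `(n - 2)`-spaces. It preserves and reflects adjacency (reflection uses that `S` is a
subspace) and carries lines onto lines; this is `GrassEmb`. The `l`-spaces through an `(l -
1)`-space (a star) or inside an `(l + 1)`-space (a top) form cliques, so by
`common_subspace_or_superspace` the images either contain a common `(n - 3)`-space `X` (`CommonSub`)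
or lie in a totally singular `(n - 1)`-space `H` (`CommonSup`). An incident star and top cannot both
be of the second kind (`not_commonSup_both`), and by connectedness all tops have the same kind
(`commonSub_top_of_adjacent`); by duality so do all stars. A star of the first kind sits in the
residue of `X`, where cliques have bounded size: its image consists of the points of a plane `M/X`
with `M` totally singular of dimension `n`, which forces `dim V = l + 2`
(`exists_of_commonSub_star`). Dually a top of the first kind forces `l = 2`. As one of the two kinds
of cliques is of the first kind, the restriction on `l` follows. Three cases remain. If both are of
the first kind, then `l = 2`, `dim V = 4`, all the spaces `X` coincide, and `S` consists of all
points above `X` (`surj_of_forall_le`): this is the Klein correspondence. If tops are of the first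
kind and stars of the second, then `l = 2` and each 1-space `A` has its own `H A`; these are
hyperplanes of one maximal `M`, closed under pencils, hence are all hyperplanes above some `X`, and
`S` is the interval from `X` to `M` (`exists_interval_of_commonSup_star`). The last case is dual. In
each case `S` is the shadow of a flag formed from `X` and, where present, `M`. -/

set_option linter.unusedSectionVars false

/-! ### Dimension arguments and cliques in Grassmannians -/

section LinearAlgebra

variable {F : Type*} [Field F] {V : Type*} [AddCommGroup V] [Module F V] [FiniteDimensional F V]

theorem finrank_sup_add_inf (U T : Submodule F V) :
    finrank F (U ⊔ T : Submodule F V) + finrank F (U ⊓ T : Submodule F V) =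
      finrank F U + finrank F T :=
  Submodule.finrank_sup_add_finrank_inf_eq U T

theorem finrank_sup_span_singleton {U : Submodule F V} {x : V} (hx : x ∉ U) :
    finrank F (U ⊔ F ∙ x : Submodule F V) = finrank F U + 1 := by
  have h0 : x ≠ 0 := fun h => hx (h ▸ U.zero_mem)
  have h := finrank_sup_add_inf U (F ∙ x)
  have hd : U ⊓ F ∙ x = ⊥ := by
    rw [← disjoint_iff]
    exact ((Submodule.disjoint_span_singleton' h0).2 hx)
  rw [hd, finrank_bot, finrank_span_singleton h0] at h
  omega

theorem exists_between_finrank_eq {U T : Submodule F V} (h : U ≤ T) {k : ℕ}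
    (hU : finrank F U ≤ k) (hT : k ≤ finrank F T) :
    ∃ X : Submodule F V, U ≤ X ∧ X ≤ T ∧ finrank F X = k := by
  induction k, hU using Nat.le_induction with
  | base => exact ⟨U, le_rfl, h, rfl⟩
  | succ k hk ih =>
    obtain ⟨X, hUX, hXT, hX⟩ := ih (by omega)
    have : ¬ T ≤ X := fun hle => by
      have := Submodule.finrank_mono hle
      omega
    obtain ⟨x, hxT, hxX⟩ := Set.not_subset.1 this
    refine ⟨X ⊔ F ∙ x, hUX.trans le_sup_left, sup_le hXT ?_, ?_⟩
    · rwa [Submodule.span_singleton_le_iff_mem]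
    · rw [finrank_sup_span_singleton hxX, hX]

theorem exists_finrank_eq_of_le (T : Submodule F V) {k : ℕ} (hT : k ≤ finrank F T) :
    ∃ X : Submodule F V, X ≤ T ∧ finrank F X = k := by
  obtain ⟨X, -, h1, h2⟩ := exists_between_finrank_eq (bot_le : ⊥ ≤ T) (k := k) (by simp) hT
  exact ⟨X, h1, h2⟩

/-- A subspace of prescribed dimension between `A` and `C` that does not contain `B`. -/
theorem exists_between_finrank_eq_not_le {A B C : Submodule F V} (hAC : A ≤ C) (hAB : A < B)
    {k : ℕ} (hA : finrank F A ≤ k) (hk : k < finrank F C) :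
    ∃ X : Submodule F V, A ≤ X ∧ X ≤ C ∧ finrank F X = k ∧ ¬ B ≤ X := by
  induction k, hA using Nat.le_induction with
  | base => exact ⟨A, le_rfl, hAC, rfl, not_le_of_gt hAB⟩
  | succ k hk' ih =>
    obtain ⟨X, hAX, hXC, hX, hBX⟩ := ih (by omega)
    by_contra! hcon
    have key : ∀ x ∈ C, x ∉ X → B ≤ X ⊔ F ∙ x := fun x hxC hxX =>
      hcon _ (hAX.trans le_sup_left)
        (sup_le hXC (by rwa [Submodule.span_singleton_le_iff_mem]))
        (by rw [finrank_sup_span_singleton hxX, hX])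
    have hnot : ∀ Y : Submodule F V, finrank F Y ≤ k + 1 → ∃ x ∈ C, x ∉ Y := fun Y hY => by
      have : ¬ C ≤ Y := fun hle => by
        have := Submodule.finrank_mono hle
        omega
      obtain ⟨x, hx, hx'⟩ := Set.not_subset.1 this
      exact ⟨x, hx, hx'⟩
    obtain ⟨x, hxC, hxX⟩ := hnot X (by omega)
    have dx := finrank_sup_span_singleton hxX
    obtain ⟨y, hyC, hyX⟩ := hnot (X ⊔ F ∙ x) (by omega)
    have hyX' : y ∉ X := fun h => hyX (Submodule.mem_sup_left h)
    have dy := finrank_sup_span_singleton hyX'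
    have dxy := finrank_sup_span_singleton hyX
    -- If every one-step extension of `X` inside `C` contained `B`, so would the intersection of two
    -- of them, which is `X` itself.
    have hinf : X = (X ⊔ F ∙ x) ⊓ (X ⊔ F ∙ y) := by
      apply Submodule.eq_of_le_of_finrank_le (le_inf le_sup_left le_sup_left)
      have h1 := finrank_sup_add_inf (X ⊔ F ∙ x) (X ⊔ F ∙ y)
      have h2 : X ⊔ F ∙ x ⊔ (X ⊔ F ∙ y) = X ⊔ F ∙ x ⊔ F ∙ y := by
        rw [← sup_sup_distrib_left, sup_assoc]
      rw [h2] at h1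
      omega
    exact hBX (hinf ▸ le_inf (key x hxC hxX) (key y hyC hyX'))

theorem inf_eq_of_finrank {U T A : Submodule F V} (hU : A ≤ U) (hT : A ≤ T)
    (h : finrank F (U ⊓ T : Submodule F V) ≤ finrank F A) : U ⊓ T = A :=
  (Submodule.eq_of_le_of_finrank_le (le_inf hU hT) h).symm

theorem sup_eq_of_finrank {U T A : Submodule F V} (hU : U ≤ A) (hT : T ≤ A)
    (h : finrank F A ≤ finrank F (U ⊔ T : Submodule F V)) : U ⊔ T = A :=
  Submodule.eq_of_le_of_finrank_le (sup_le hU hT) h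

/-- Distinct subspaces of equal dimension meet in a smaller subspace. -/
theorem finrank_inf_lt {U T : Submodule F V} (hne : U ≠ T) (h : finrank F U = finrank F T) :
    finrank F (U ⊓ T : Submodule F V) < finrank F U := by
  by_contra! hc
  have h1 : U ⊓ T = U := Submodule.eq_of_le_of_finrank_le inf_le_left hc
  exact hne (Submodule.eq_of_le_of_finrank_eq (inf_eq_left.1 h1) h)

/-- A family of subspaces of dimension `k + 1` that pairwise meet in codimension one either has a
common `k`-subspace or lies in a common `(k + 2)`-space. -/
theorem common_subspace_or_superspace {k : ℕ} {𝓑 : Set (Submodule F V)}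
    (hdim : ∀ B ∈ 𝓑, finrank F B = k + 1)
    (hpair : ∀ B ∈ 𝓑, ∀ B' ∈ 𝓑, B ≠ B' → finrank F (B ⊓ B' : Submodule F V) = k)
    (hnt : 𝓑.Nontrivial) :
    (∃ X : Submodule F V, finrank F X = k ∧ ∀ B ∈ 𝓑, X ≤ B) ∨
      ∃ H : Submodule F V, finrank F H = k + 2 ∧ ∀ B ∈ 𝓑, B ≤ H := by
  obtain ⟨B₁, h₁, B₂, h₂, h12⟩ := hnt
  have d12 := hpair _ h₁ _ h₂ h12
  -- `D` meets `C` and `C'` in two different hyperplanes of `D`, and these span `D`.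
  have key : ∀ C ∈ 𝓑, ∀ C' ∈ 𝓑, ∀ D ∈ 𝓑, C ≠ C' → ¬ C ⊓ C' ≤ D → D ≤ C ⊔ C' := by
    intro C hC C' hC' D hD hne hn
    have hCD : C ≠ D := fun h => hn (h ▸ inf_le_left)
    have hCD' : C' ≠ D := fun h => hn (h ▸ inf_le_right)
    have e1 := hpair _ hC _ hD hCD
    have e2 := hpair _ hC' _ hD hCD'
    have hne' : C ⊓ D ≠ C' ⊓ D := by
      intro h
      have : C ⊓ D ≤ C ⊓ C' := le_inf inf_le_left (h ▸ inf_le_left)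
      have := Submodule.eq_of_le_of_finrank_eq this (by rw [e1, hpair _ hC _ hC' hne])
      exact hn (this ▸ inf_le_right)
    have hlt := finrank_inf_lt hne' (by omega)
    have hs := finrank_sup_add_inf (C ⊓ D) (C' ⊓ D)
    have : C ⊓ D ⊔ C' ⊓ D = D :=
      sup_eq_of_finrank inf_le_right inf_le_right (by rw [hdim D hD]; omega)
    rw [← this]
    exact sup_le_sup inf_le_left inf_le_left
  by_cases hall : ∀ B ∈ 𝓑, B₁ ⊓ B₂ ≤ B
  · exact Or.inl ⟨_, d12, hall⟩
  · push Not at hall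
    obtain ⟨B₃, h₃, hn3⟩ := hall
    have hB3 := key _ h₁ _ h₂ _ h₃ h12 hn3
    have h13 : B₁ ≠ B₃ := fun h => hn3 (h ▸ inf_le_left)
    refine Or.inr ⟨B₁ ⊔ B₂, ?_, fun D hD => ?_⟩
    · have := finrank_sup_add_inf B₁ B₂
      rw [hdim _ h₁, hdim _ h₂] at this
      omega
    · by_cases hD1 : B₁ ⊓ B₂ ≤ D
      -- `key` applies to `B₁, B₂` or to `B₁, B₃` unless `D` contains both intersections; these span
      -- `B₁`, so then `D = B₁`.
      · by_cases hD2 : B₁ ⊓ B₃ ≤ D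
        · have d13 := hpair _ h₁ _ h₃ h13
          have hne : B₁ ⊓ B₂ ≠ B₁ ⊓ B₃ := fun h => hn3 (h ▸ inf_le_right)
          have hlt := finrank_inf_lt hne (by omega)
          have hs := finrank_sup_add_inf (B₁ ⊓ B₂) (B₁ ⊓ B₃)
          have e : B₁ ⊓ B₂ ⊔ B₁ ⊓ B₃ = B₁ :=
            sup_eq_of_finrank inf_le_left inf_le_left (by rw [hdim _ h₁]; omega)
          have : B₁ = D := Submodule.eq_of_le_of_finrank_eq (e ▸ sup_le hD1 hD2)
            (by rw [hdim _ h₁, hdim _ hD])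
          exact this ▸ le_sup_left
        · exact (key _ h₁ _ h₃ _ hD h13 hD2).trans (sup_le le_sup_left hB3)
      · exact key _ h₁ _ h₂ _ hD h12 hD1

/-- Any two subspaces of dimension `k` are joined by a chain of such subspaces in which
consecutive members meet in codimension one. -/
theorem grassmannian_connected {k : ℕ} {p : Submodule F V → Prop}
    (hp : ∀ C D : Submodule F V, finrank F C = k → finrank F D = k →
      finrank F (C ⊓ D : Submodule F V) + 1 = k → p C → p D)
    {C D : Submodule F V} (hC : finrank F C = k) (hD : finrank F D = k) (h : p C) : p D := by
  obtain ⟨r, hr⟩ : ∃ r, k ≤ finrank F (C ⊓ D : Submodule F V) + r := ⟨k, by omega⟩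
  induction r generalizing C with
  | zero =>
    by_cases hne : C = D
    · exact hne ▸ h
    · have := finrank_inf_lt hne (by omega)
      omega
  | succ r ih =>
    by_cases hCD : C = D
    · exact hCD ▸ h
    have hltk := finrank_inf_lt hCD (by omega)
    have hlt : ¬ D ≤ C := fun hle => by
      exact hCD (Submodule.eq_of_le_of_finrank_eq hle (by omega)).symm
    obtain ⟨x, hxD, hxC⟩ := Set.not_subset.1 hlt
    obtain ⟨Y, hY1, hY2, hY⟩ := exists_between_finrank_eq (inf_le_left : C ⊓ D ≤ C) (k := k - 1)
      (by omega) (by omega)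
    have hxY : x ∉ Y := fun h => hxC (hY2 h)
    have hxI : x ∉ C ⊓ D := fun h => hxC h.1
    have d1 := finrank_sup_span_singleton hxY
    have d2 := finrank_sup_span_singleton hxI
    -- The next member of the chain trades one dimension of `C` outside `D` for a vector `x` of `D`,
    -- which enlarges the intersection with `D`.
    have hE : finrank F (Y ⊔ F ∙ x : Submodule F V) = k := by omega
    have hne : C ≠ Y ⊔ F ∙ x := fun h =>
      hxC (h ▸ Submodule.mem_sup_right (Submodule.mem_span_singleton_self x))
    have hCE : finrank F (C ⊓ (Y ⊔ F ∙ x) : Submodule F V) + 1 = k := by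
      have h1 := finrank_inf_lt hne (by omega)
      have h2 := Submodule.finrank_mono (le_inf hY2 le_sup_left : Y ≤ C ⊓ (Y ⊔ F ∙ x))
      omega
    have hlt2 := Submodule.finrank_mono (show C ⊓ D ⊔ F ∙ x ≤ (Y ⊔ F ∙ x) ⊓ D from
      le_inf (sup_le_sup_right hY1 _)
        (sup_le inf_le_right (by rwa [Submodule.span_singleton_le_iff_mem])))
    exact ih hE (hp _ _ hC hE hCE h) (by omega)

end LinearAlgebra

/-! ### Totally singular subspaces and polar orthogonality -/

section TotallySingular

variable {F : Type*} [Field F] {W : Type*} [AddCommGroup W] [Module F W] {Q : QuadraticForm F W}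

theorem IsTotSingular.mono {U T : Submodule F W} (hT : IsTotSingular Q T) (h : U ≤ T) :
    IsTotSingular Q U := fun x hx => hT x (h hx)

theorem IsTotSingular.polar_eq_zero {U : Submodule F W} (hU : IsTotSingular Q U) {x y : W}
    (hx : x ∈ U) (hy : y ∈ U) : QuadraticMap.polar Q x y = 0 := by
  simp [QuadraticMap.polar, hU _ hx, hU _ hy, hU _ (U.add_mem hx hy)]

theorem IsTotSingular.sup {U T : Submodule F W} (hU : IsTotSingular Q U) (hT : IsTotSingular Q T)
    (h : ∀ x ∈ U, ∀ y ∈ T, QuadraticMap.polar Q x y = 0) : IsTotSingular Q (U ⊔ T) := by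
  intro z hz
  obtain ⟨x, hx, y, hy, rfl⟩ := Submodule.mem_sup.1 hz
  rw [QuadraticMap.map_add Q, hU x hx, hT y hy, h x hx y hy]
  simp

theorem IsTotSingular.sup_sup {U T R : Submodule F W} (hUT : IsTotSingular Q (U ⊔ T))
    (hUR : IsTotSingular Q (U ⊔ R)) (hTR : IsTotSingular Q (T ⊔ R)) :
    IsTotSingular Q (U ⊔ T ⊔ R) := by
  refine hUT.sup (hUR.mono le_sup_right) ?_
  intro z hz r hr
  obtain ⟨x, hx, y, hy, rfl⟩ := Submodule.mem_sup.1 hz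
  rw [QuadraticMap.polar_add_left,
    hUR.polar_eq_zero (Submodule.mem_sup_left hx) (Submodule.mem_sup_right hr),
    hTR.polar_eq_zero (Submodule.mem_sup_left hy) (Submodule.mem_sup_right hr), add_zero]

theorem isTotSingular_span_singleton {x : W} (hx : Q x = 0) : IsTotSingular Q (F ∙ x) := by
  intro y hy
  obtain ⟨a, rfl⟩ := Submodule.mem_span_singleton.1 hy
  rw [QuadraticMap.map_smul, hx, smul_zero]

/-- The orthogonal space with respect to the polar form. -/
def polarPerp (Q : QuadraticForm F W) (U : Submodule F W) : Submodule F W :=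
  LinearMap.BilinForm.orthogonal (QuadraticMap.polarBilin Q) U

theorem mem_polarPerp {U : Submodule F W} {x : W} :
    x ∈ polarPerp Q U ↔ ∀ y ∈ U, QuadraticMap.polar Q y x = 0 :=
  LinearMap.BilinForm.mem_orthogonal_iff

theorem IsTotSingular.le_polarPerp {U : Submodule F W} (hU : IsTotSingular Q U) :
    U ≤ polarPerp Q U :=
  fun _ hx => mem_polarPerp.2 fun _ hy => hU.polar_eq_zero hy hx

theorem IsTotSingular.sup_of_le_polarPerp {U T : Submodule F W} (hU : IsTotSingular Q U)
    (hT : IsTotSingular Q T) (h : T ≤ polarPerp Q U) : IsTotSingular Q (U ⊔ T) :=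
  hU.sup hT fun x hx _ hy => mem_polarPerp.1 (h hy) x hx

theorem polarPerp_sup (U T : Submodule F W) :
    polarPerp Q (U ⊔ T) = polarPerp Q U ⊓ polarPerp Q T := by
  ext z
  simp only [Submodule.mem_inf, mem_polarPerp]
  refine ⟨fun h => ⟨fun y hy => h y (Submodule.mem_sup_left hy),
    fun y hy => h y (Submodule.mem_sup_right hy)⟩, fun h y hy => ?_⟩
  obtain ⟨a, ha, b, hb, rfl⟩ := Submodule.mem_sup.1 hy
  rw [QuadraticMap.polar_add_left, h.1 a ha, h.2 b hb, add_zero]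

end TotallySingular

/-! ### Maximal totally singular subspaces of a hyperbolic form -/

namespace IsHyperbolicForm

variable {F : Type*} [Field F] {W : Type*} [AddCommGroup W] [Module F W] {Q : QuadraticForm F W}
  {n : ℕ}

theorem finrank_polarPerp (hQ : IsHyperbolicForm Q n) (U : Submodule F W) :
    finrank F (polarPerp Q U) + finrank F U = 2 * n := by
  have := hQ.finiteDimensional
  have h := LinearMap.BilinForm.finrank_orthogonal hQ.nondegenerate U
  have h2 := Submodule.finrank_le U
  rw [hQ.finrank_eq] at h h2
  unfold polarPerp
  omega

theorem finrank_le (hQ : IsHyperbolicForm Q n) {U : Submodule F W} (hU : IsTotSingular Q U) :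
    finrank F U ≤ n := by
  have := hQ.finiteDimensional
  have h1 := Submodule.finrank_mono hU.le_polarPerp
  have h2 := hQ.finrank_polarPerp U
  omega

theorem polarPerp_eq_self (hQ : IsHyperbolicForm Q n) {U : Submodule F W}
    (hU : IsTotSingular Q U) (hd : finrank F U = n) : polarPerp Q U = U := by
  have := hQ.finiteDimensional
  refine (Submodule.eq_of_le_of_finrank_le hU.le_polarPerp ?_).symm
  have h2 := hQ.finrank_polarPerp U
  omega

/-- A totally singular subspace and its perp in a maximal one span a maximal totally singular
subspace. -/
theorem sup_inf_polarPerp (hQ : IsHyperbolicForm Q n) {U M : Submodule F W}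
    (hU : IsTotSingular Q U) (hM : IsTotSingular Q M) (hd : finrank F M = n) :
    IsTotSingular Q (U ⊔ M ⊓ polarPerp Q U) ∧
      finrank F (U ⊔ M ⊓ polarPerp Q U : Submodule F W) = n := by
  have := hQ.finiteDimensional
  refine ⟨hU.sup_of_le_polarPerp (hM.mono inf_le_left) inf_le_right, ?_⟩
  have h1 : M ⊓ polarPerp Q U = polarPerp Q (M ⊔ U) := by
    rw [polarPerp_sup, hQ.polarPerp_eq_self hM hd]
  have h2 := hQ.finrank_polarPerp (M ⊔ U)
  have h3 := finrank_sup_add_inf M U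
  have h4 := finrank_sup_add_inf U (M ⊓ polarPerp Q U)
  have h5 : U ⊓ (M ⊓ polarPerp Q U) = M ⊓ U := by
    apply le_antisymm
    · exact le_inf (inf_le_right.trans inf_le_left) inf_le_left
    · exact le_inf inf_le_right (le_inf inf_le_left (inf_le_right.trans hU.le_polarPerp))
  rw [h5, h1] at h4
  rw [← h1] at h2 h4
  omega

/-- A totally singular `(n - 1)`-space is the intersection of two maximal ones. -/
theorem exists_inf_eq (hQ : IsHyperbolicForm Q n) {H : Submodule F W}
    (hH : IsTotSingular Q H) (hd : finrank F H + 1 = n) :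
    ∃ L₁ L₂ : Submodule F W, IsTotSingular Q L₁ ∧ finrank F L₁ = n ∧
      IsTotSingular Q L₂ ∧ finrank F L₂ = n ∧ L₁ ⊓ L₂ = H := by
  have := hQ.finiteDimensional
  obtain ⟨M, hM, hMd⟩ := hQ.exists_totSingular
  obtain ⟨hL, hLd⟩ := hQ.sup_inf_polarPerp hH hM hMd
  set L₁ := H ⊔ M ⊓ polarPerp Q H
  have hHL : H ≤ L₁ := le_sup_left
  have hp := hQ.finrank_polarPerp H
  obtain ⟨x, hxL, hxH⟩ := Set.not_subset.1 (show ¬ L₁ ≤ H from fun h => by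
    have := Submodule.finrank_mono h
    omega)
  obtain ⟨y, hyH, hyL⟩ := Set.not_subset.1 (show ¬ polarPerp Q H ≤ L₁ from fun h => by
    have := Submodule.finrank_mono h
    omega)
  have hHx : H ⊔ F ∙ x = L₁ := by
    apply sup_eq_of_finrank hHL (by rwa [Submodule.span_singleton_le_iff_mem])
    rw [finrank_sup_span_singleton hxH]
    omega
  have hxy : QuadraticMap.polar Q x y ≠ 0 := by
    intro h0
    apply hyL
    rw [← hQ.polarPerp_eq_self hL hLd, ← hHx, polarPerp_sup]
    refine ⟨hyH, mem_polarPerp.2 fun z hz => ?_⟩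
    obtain ⟨a, rfl⟩ := Submodule.mem_span_singleton.1 hz
    rw [QuadraticMap.polar_smul_left, h0, smul_zero]
  -- Since `x` is singular, `Q (y + c x) = Q y + c · polar x y`; this `c` makes it vanish in every
  -- characteristic.
  set z := y + (-(Q y) / QuadraticMap.polar Q x y) • x with hz
  have hQz : Q z = 0 := by
    rw [hz, QuadraticMap.map_add Q, QuadraticMap.map_smul, hL x hxL,
      QuadraticMap.polar_smul_right, QuadraticMap.polar_comm Q y x, smul_zero, add_zero,
      smul_eq_mul, div_mul_cancel₀ _ hxy, add_neg_cancel]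
  have hzL : z ∉ L₁ := fun h => hyL (by
    have := L₁.sub_mem h (L₁.smul_mem (-(Q y) / QuadraticMap.polar Q x y) hxL)
    rwa [hz, add_sub_cancel_right] at this)
  have hzp : z ∈ polarPerp Q H :=
    (polarPerp Q H).add_mem hyH (Submodule.smul_mem _ _
      (mem_polarPerp.2 fun w hw => hL.polar_eq_zero (hHL hw) hxL))
  have hzH : z ∉ H := fun h => hzL (hHL h)
  have dz := finrank_sup_span_singleton hzH
  refine ⟨L₁, H ⊔ F ∙ z, hL, hLd, hH.sup_of_le_polarPerp (isTotSingular_span_singleton hQz)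
    (by rwa [Submodule.span_singleton_le_iff_mem]), by omega, ?_⟩
  apply inf_eq_of_finrank hHL le_sup_left
  have hne : L₁ ≠ H ⊔ F ∙ z := fun h =>
    hzL (h ▸ Submodule.mem_sup_right (Submodule.mem_span_singleton_self z))
  have := finrank_inf_lt hne (by omega)
  omega

/-- A totally singular `(n - 1)`-space lies in at most two maximal ones. -/
theorem eq_or_eq_of_le (hQ : IsHyperbolicForm Q n) {K M₁ M₂ M₃ : Submodule F W}
    (hd : finrank F K + 1 = n)
    (h₁ : IsTotSingular Q M₁) (d₁ : finrank F M₁ = n) (k₁ : K ≤ M₁)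
    (h₂ : IsTotSingular Q M₂) (d₂ : finrank F M₂ = n) (k₂ : K ≤ M₂)
    (h₃ : IsTotSingular Q M₃) (d₃ : finrank F M₃ = n) (k₃ : K ≤ M₃) (hne : M₁ ≠ M₂) :
    M₃ = M₁ ∨ M₃ = M₂ := by
  have := hQ.finiteDimensional
  have hsplit : ∀ M : Submodule F W, finrank F M = n → K ≤ M → ∃ x ∈ M, K ⊔ F ∙ x = M := by
    intro M dM kM
    obtain ⟨x, hxM, hxK⟩ := Set.not_subset.1 (show ¬ M ≤ K from fun h => by
      have := Submodule.finrank_mono h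
      omega)
    refine ⟨x, hxM, sup_eq_of_finrank kM (by rwa [Submodule.span_singleton_le_iff_mem]) ?_⟩
    rw [finrank_sup_span_singleton hxK]
    omega
  obtain ⟨x, hx, ex⟩ := hsplit M₁ d₁ k₁
  obtain ⟨y, hy, ey⟩ := hsplit M₂ d₂ k₂
  obtain ⟨z, hz, ez⟩ := hsplit M₃ d₃ k₃
  have hinf : M₁ ⊓ M₂ = K := by
    apply inf_eq_of_finrank k₁ k₂
    have := finrank_inf_lt hne (by omega)
    omega
  have hsup := finrank_sup_add_inf M₁ M₂
  rw [hinf] at hsup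
  have hpK := hQ.finrank_polarPerp K
  have hperp : ∀ M : Submodule F W, IsTotSingular Q M → K ≤ M → M ≤ polarPerp Q K :=
    fun M hM kM w hw => mem_polarPerp.2 fun v hv => hM.polar_eq_zero (kM hv) hw
  have hKp : M₁ ⊔ M₂ = polarPerp Q K :=
    sup_eq_of_finrank (hperp _ h₁ k₁) (hperp _ h₂ k₂) (by omega)
  -- Otherwise `M₁ ⊔ M₂` would be totally singular of dimension `n + 1`.
  have hxy : QuadraticMap.polar Q x y ≠ 0 := by
    intro h0
    have hts : IsTotSingular Q (M₁ ⊔ M₂) := by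
      apply h₁.sup_of_le_polarPerp h₂
      rw [← ex, polarPerp_sup]
      refine le_inf (hperp _ h₂ k₂) ?_
      rw [← ey]
      refine sup_le (fun w hw => mem_polarPerp.2 fun v hv => ?_) ?_
      · refine h₁.polar_eq_zero ?_ (k₁ hw)
        exact (Submodule.span_singleton_le_iff_mem _ _).2 hx hv
      · rw [Submodule.span_singleton_le_iff_mem]
        refine mem_polarPerp.2 fun v hv => ?_
        obtain ⟨a, rfl⟩ := Submodule.mem_span_singleton.1 hv
        rw [QuadraticMap.polar_smul_left, h0, smul_zero]
    have := hQ.finrank_le hts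
    omega
  have hzs : z ∈ M₁ ⊔ M₂ := hKp ▸ hperp _ h₃ k₃ hz
  obtain ⟨u, hu, w, hw, huw⟩ := Submodule.mem_sup.1 hzs
  rw [← ex] at hu
  rw [← ey] at hw
  obtain ⟨k, hk, _, hax, rfl⟩ := Submodule.mem_sup.1 hu
  obtain ⟨a, rfl⟩ := Submodule.mem_span_singleton.1 hax
  obtain ⟨k', hk', _, hby, rfl⟩ := Submodule.mem_sup.1 hw
  obtain ⟨b, rfl⟩ := Submodule.mem_span_singleton.1 hby
  -- The quotient of the perp of `K` by `K` is a hyperbolic plane: modulo `K`, `z` is `a x + b y`,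
  -- where `Q` takes the value `a b · polar x y`. So its only singular lines are those of `M₁` and
  -- `M₂`.
  have hab : a * b = 0 := by
    have e : z - (k + k') = a • x + b • y := by rw [← huw]; abel
    have h0 : Q (a • x + b • y) = 0 := e ▸ h₃ _ (M₃.sub_mem hz (k₃ (K.add_mem hk hk')))
    rw [QuadraticMap.map_add Q, QuadraticMap.map_smul, QuadraticMap.map_smul, h₁ x hx, h₂ y hy,
      QuadraticMap.polar_smul_left, QuadraticMap.polar_smul_right] at h0
    simpa [hxy] using h0
  rcases mul_eq_zero.1 hab with rfl | rfl
  · refine Or.inr (Submodule.eq_of_le_of_finrank_eq (ez ▸ sup_le k₂ ?_) (d₃.trans d₂.symm))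
    rw [Submodule.span_singleton_le_iff_mem, ← huw]
    refine M₂.add_mem (by simpa using k₂ hk) (M₂.add_mem (k₂ hk') (M₂.smul_mem _ hy))
  · refine Or.inl (Submodule.eq_of_le_of_finrank_eq (ez ▸ sup_le k₁ ?_) (d₃.trans d₁.symm))
    rw [Submodule.span_singleton_le_iff_mem, ← huw]
    refine M₁.add_mem (M₁.add_mem (k₁ hk) (M₁.smul_mem _ hx)) (by simpa using k₁ hk')

end IsHyperbolicForm

/-! ### Embedded Grassmannians: the two kinds of stars and tops -/

section Grassmannian

variable {F : Type*} [Field F] {V : Type*} [AddCommGroup V] [Module F V]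
  {W : Type*} [AddCommGroup W] [Module F W] {Q : QuadraticForm F W} {n l : ℕ}
  {f : Submodule F V → Submodule F W}

/-- The map `f` identifies the `l`-Grassmannian of `V` with a subspace of the geometry of totally
singular `(n - 2)`-spaces. Its values on subspaces of other dimensions are irrelevant. -/
structure GrassEmb (Q : QuadraticForm F W) (n l : ℕ) (f : Submodule F V → Submodule F W) :
    Prop where
  two_le : 2 ≤ l
  le_finrank : l + 2 ≤ finrank F V
  ts : ∀ B : Submodule F V, finrank F B = l → IsTotSingular Q (f B)
  dim : ∀ B : Submodule F V, finrank F B = l → finrank F (f B) + 2 = n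
  inj : ∀ B B' : Submodule F V, finrank F B = l → finrank F B' = l → f B = f B' → B = B'
  coll : ∀ B B' : Submodule F V, finrank F B = l → finrank F B' = l →
    finrank F (B ⊓ B' : Submodule F V) + 1 = l →
    IsTotSingular Q (f B ⊔ f B') ∧ finrank F (f B ⊔ f B' : Submodule F W) + 1 = n
  coll_rev : ∀ B B' : Submodule F V, finrank F B = l → finrank F B' = l →
    IsTotSingular Q (f B ⊔ f B') → finrank F (f B ⊔ f B' : Submodule F W) + 1 = n →
    finrank F (B ⊓ B' : Submodule F V) + 1 = l
  line : ∀ B B' : Submodule F V, finrank F B = l → finrank F B' = l →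
    finrank F (B ⊓ B' : Submodule F V) + 1 = l → ∀ P : Submodule F W, finrank F P + 2 = n →
    f B ⊓ f B' ≤ P → P ≤ f B ⊔ f B' →
    ∃ D : Submodule F V, finrank F D = l ∧ B ⊓ B' ≤ D ∧ D ≤ B ⊔ B' ∧ f D = P

/-- The `l`-spaces containing `A`. -/
def grassStar (l : ℕ) (A : Submodule F V) : Set (Submodule F V) := {B | finrank F B = l ∧ A ≤ B}

/-- The `l`-spaces contained in `C`. -/
def grassTop (l : ℕ) (C : Submodule F V) : Set (Submodule F V) := {B | finrank F B = l ∧ B ≤ C}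

/-- The images of the members of `𝓓` contain the `(n - 3)`-space `X`. -/
def CommonSub (n : ℕ) (f : Submodule F V → Submodule F W) (𝓓 : Set (Submodule F V))
    (X : Submodule F W) : Prop :=
  finrank F X + 3 = n ∧ ∀ B ∈ 𝓓, X ≤ f B

/-- The images of the members of `𝓓` lie in the totally singular `(n - 1)`-space `H`. -/
def CommonSup (Q : QuadraticForm F W) (n : ℕ) (f : Submodule F V → Submodule F W)
    (𝓓 : Set (Submodule F V)) (H : Submodule F W) : Prop :=
  finrank F H + 1 = n ∧ IsTotSingular Q H ∧ ∀ B ∈ 𝓓, f B ≤ H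

variable [FiniteDimensional F V] [FiniteDimensional F W]

theorem inf_eq_of_star {A B B' : Submodule F V} (hA : finrank F A + 1 = l) (hB : B ∈ grassStar l A)
    (hB' : B' ∈ grassStar l A) (hne : B ≠ B') : B ⊓ B' = A := by
  apply inf_eq_of_finrank hB.2 hB'.2
  have := finrank_inf_lt hne (hB.1.trans hB'.1.symm)
  have := hB.1
  omega

theorem sup_eq_of_top {C B B' : Submodule F V} (hC : finrank F C = l + 1) (hB : B ∈ grassTop l C)
    (hB' : B' ∈ grassTop l C) (hne : B ≠ B') : B ⊔ B' = C := by
  apply sup_eq_of_finrank hB.2 hB'.2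
  have := finrank_inf_lt hne (hB.1.trans hB'.1.symm)
  have := hB.1
  have := hB'.1
  have := finrank_sup_add_inf B B'
  omega

theorem finrank_inf_of_star {A B B' : Submodule F V} (hA : finrank F A + 1 = l)
    (hB : B ∈ grassStar l A) (hB' : B' ∈ grassStar l A) (hne : B ≠ B') :
    finrank F (B ⊓ B' : Submodule F V) + 1 = l := by
  rw [inf_eq_of_star hA hB hB' hne, hA]

theorem finrank_inf_of_top {C B B' : Submodule F V} (hC : finrank F C = l + 1)
    (hB : B ∈ grassTop l C) (hB' : B' ∈ grassTop l C) (hne : B ≠ B') :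
    finrank F (B ⊓ B' : Submodule F V) + 1 = l := by
  have h := finrank_sup_add_inf B B'
  rw [sup_eq_of_top hC hB hB' hne, hC, hB.1, hB'.1] at h
  omega

/-- Two distinct members of the pencil of a pair `A ≤ C`. -/
theorem exists_pencil {A C : Submodule F V} (h : A ≤ C) (hA : finrank F A + 1 = l)
    (hC : finrank F C = l + 1) : ∃ B B' : Submodule F V,
      B ∈ grassStar l A ∧ B ∈ grassTop l C ∧ B' ∈ grassStar l A ∧ B' ∈ grassTop l C ∧ B ≠ B' := by
  obtain ⟨B, h1, h2, h3⟩ := exists_between_finrank_eq h (k := l) (by omega) (by omega)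
  have hlt : A < B := lt_of_le_of_ne h1 (by rintro rfl; omega)
  obtain ⟨B', h1', h2', h3', h4⟩ := exists_between_finrank_eq_not_le h hlt (k := l)
    (by omega) (by omega)
  exact ⟨B, B', ⟨h3, h1⟩, ⟨h3, h2⟩, ⟨h3', h1'⟩, ⟨h3', h2'⟩, fun e => h4 (e ▸ le_rfl)⟩

/-- A second member of a pencil. -/
theorem exists_pencil_ne {A B C : Submodule F V} (hAB : A ≤ B) (hBC : B ≤ C)
    (hA : finrank F A + 1 = l) (hB : finrank F B = l) (hC : finrank F C = l + 1) :
    ∃ B' : Submodule F V, B' ∈ grassStar l A ∧ B' ∈ grassTop l C ∧ B ≠ B' := by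
  have hlt : A < B := lt_of_le_of_ne hAB (by rintro rfl; omega)
  obtain ⟨B', h1', h2', h3', h4⟩ := exists_between_finrank_eq_not_le (hAB.trans hBC) hlt (k := l)
    (by omega) (by omega)
  exact ⟨B', ⟨h3', h1'⟩, ⟨h3', h2'⟩, fun e => h4 (e ▸ le_rfl)⟩

theorem exists_star_not_le {A C : Submodule F V} (hAC : A ≤ C) (hA : finrank F A + 1 = l)
    (hC : finrank F C < finrank F V) : ∃ D ∈ grassStar l A, ¬ D ≤ C := by
  have : ¬ (⊤ : Submodule F V) ≤ C := fun h => by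
    have := Submodule.finrank_mono h
    rw [finrank_top] at this
    omega
  obtain ⟨x, -, hx⟩ := Set.not_subset.1 this
  have hxA : x ∉ A := fun h => hx (hAC h)
  exact ⟨A ⊔ F ∙ x, ⟨by rw [finrank_sup_span_singleton hxA, hA], le_sup_left⟩,
    fun h => hx (h (Submodule.mem_sup_right (Submodule.mem_span_singleton_self x)))⟩

namespace GrassEmb

theorem finrank_inf (hE : GrassEmb Q n l f) {B B' : Submodule F V} (hB : finrank F B = l)
    (hB' : finrank F B' = l) (h : finrank F (B ⊓ B' : Submodule F V) + 1 = l) :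
    finrank F (f B ⊓ f B' : Submodule F W) + 3 = n := by
  have h1 := (hE.coll B B' hB hB' h).2
  have h2 := finrank_sup_add_inf (f B) (f B')
  have h3 := hE.dim B hB
  have h4 := hE.dim B' hB'
  omega

/-- Lines are mapped onto full lines, so by injectivity a point of the image line can only come from
the original pencil. -/
theorem mem_line (hE : GrassEmb Q n l f) {B B' D : Submodule F V} (hB : finrank F B = l)
    (hB' : finrank F B' = l) (hD : finrank F D = l)
    (h : finrank F (B ⊓ B' : Submodule F V) + 1 = l)
    (h1 : f B ⊓ f B' ≤ f D) (h2 : f D ≤ f B ⊔ f B') : B ⊓ B' ≤ D ∧ D ≤ B ⊔ B' := by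
  obtain ⟨D', hD', h3, h4, h5⟩ := hE.line B B' hB hB' h (f D) (hE.dim D hD) h1 h2
  rw [hE.inj D' D hD' hD h5] at h3 h4
  exact ⟨h3, h4⟩

/-- A clique of the Grassmannian is mapped into one of the two kinds of cliques. -/
theorem clique_type (hE : GrassEmb Q n l f) {𝓓 : Set (Submodule F V)}
    (hdim : ∀ B ∈ 𝓓, finrank F B = l)
    (hpair : ∀ B ∈ 𝓓, ∀ B' ∈ 𝓓, B ≠ B' → finrank F (B ⊓ B' : Submodule F V) + 1 = l)
    (hnt : 𝓓.Nontrivial) :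
    (∃ X, CommonSub n f 𝓓 X) ∨ ∃ H, CommonSup Q n f 𝓓 H := by
  obtain ⟨B₁, h₁, B₂, h₂, hne⟩ := hnt
  have hd := hE.finrank_inf (hdim _ h₁) (hdim _ h₂) (hpair _ h₁ _ h₂ hne)
  obtain ⟨hts, hs⟩ := hE.coll _ _ (hdim _ h₁) (hdim _ h₂) (hpair _ h₁ _ h₂ hne)
  have k₁ : ∀ P ∈ f '' 𝓓, finrank F P = n - 3 + 1 := by
    rintro _ ⟨B, hB, rfl⟩
    have := hE.dim B (hdim _ hB)
    omega
  have k₂ : ∀ P ∈ f '' 𝓓, ∀ P' ∈ f '' 𝓓, P ≠ P' →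
      finrank F (P ⊓ P' : Submodule F W) = n - 3 := by
    rintro _ ⟨B, hB, rfl⟩ _ ⟨B', hB', rfl⟩ hne'
    have := hE.finrank_inf (hdim _ hB) (hdim _ hB')
      (hpair _ hB _ hB' (fun h => hne' (h ▸ rfl)))
    omega
  rcases common_subspace_or_superspace k₁ k₂ ⟨_, ⟨B₁, h₁, rfl⟩, _, ⟨B₂, h₂, rfl⟩,
      fun h => hne (hE.inj _ _ (hdim _ h₁) (hdim _ h₂) h)⟩ with ⟨X, hX, h⟩ | ⟨H, hH, h⟩
  · exact Or.inl ⟨X, by omega, fun B hB => h _ ⟨B, hB, rfl⟩⟩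
  · have e : f B₁ ⊔ f B₂ = H :=
      sup_eq_of_finrank (h _ ⟨_, h₁, rfl⟩) (h _ ⟨_, h₂, rfl⟩) (by omega)
    exact Or.inr ⟨H, by omega, e ▸ hts, fun B hB => h _ ⟨B, hB, rfl⟩⟩

theorem star_type (hE : GrassEmb Q n l f) {A : Submodule F V} (hA : finrank F A + 1 = l) :
    (∃ X, CommonSub n f (grassStar l A) X) ∨ ∃ H, CommonSup Q n f (grassStar l A) H := by
  obtain ⟨C, hAC, -, hC⟩ := exists_between_finrank_eq (le_top : A ≤ ⊤) (k := l + 1) (by omega)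
    (by rw [finrank_top]; have := hE.le_finrank; omega)
  obtain ⟨B, B', h1, -, h2, -, hne⟩ := exists_pencil hAC hA hC
  exact hE.clique_type (fun B hB => hB.1) (fun B hB B' hB' => finrank_inf_of_star hA hB hB')
    ⟨B, h1, B', h2, hne⟩

theorem top_type (hE : GrassEmb Q n l f) {C : Submodule F V} (hC : finrank F C = l + 1) :
    (∃ X, CommonSub n f (grassTop l C) X) ∨ ∃ H, CommonSup Q n f (grassTop l C) H := by
  have := hE.two_le
  obtain ⟨A, hAC, hA⟩ := exists_finrank_eq_of_le C (k := l - 1) (by omega)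
  obtain ⟨B, B', -, h1, -, h2, hne⟩ := exists_pencil hAC (by omega) hC
  exact hE.clique_type (fun B hB => hB.1) (fun B hB B' hB' => finrank_inf_of_top hC hB hB')
    ⟨B, h1, B', h2, hne⟩

theorem inf_eq (hE : GrassEmb Q n l f) {𝓓 : Set (Submodule F V)} {X : Submodule F W}
    (hX : CommonSub n f 𝓓 X) {B B' : Submodule F V} (hB : B ∈ 𝓓) (hB' : B' ∈ 𝓓)
    (dB : finrank F B = l) (dB' : finrank F B' = l)
    (h : finrank F (B ⊓ B' : Submodule F V) + 1 = l) : f B ⊓ f B' = X := by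
  apply inf_eq_of_finrank (hX.2 _ hB) (hX.2 _ hB')
  have := hE.finrank_inf dB dB' h
  have := hX.1
  omega

theorem sup_eq (hE : GrassEmb Q n l f) {𝓓 : Set (Submodule F V)} {H : Submodule F W}
    (hH : CommonSup Q n f 𝓓 H) {B B' : Submodule F V} (hB : B ∈ 𝓓) (hB' : B' ∈ 𝓓)
    (dB : finrank F B = l) (dB' : finrank F B' = l)
    (h : finrank F (B ⊓ B' : Submodule F V) + 1 = l) : f B ⊔ f B' = H := by
  apply sup_eq_of_finrank (hH.2.2 _ hB) (hH.2.2 _ hB')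
  have := (hE.coll B B' dB dB' h).2
  have := hH.1
  omega

/-- The star and the top share a pencil, and two of its members already determine the common
subspace as the intersection of their images. -/
theorem commonSub_unique (hE : GrassEmb Q n l f) {A C : Submodule F V} (hAC : A ≤ C)
    (hA : finrank F A + 1 = l) (hC : finrank F C = l + 1) {X X' : Submodule F W}
    (hX : CommonSub n f (grassStar l A) X) (hX' : CommonSub n f (grassTop l C) X') : X = X' := by
  obtain ⟨B, B', h1, h1', h2, h2', hne⟩ := exists_pencil hAC hA hC
  have hc := finrank_inf_of_star hA h1 h2 hne
  rw [← hE.inf_eq hX h1 h2 h1.1 h2.1 hc, hE.inf_eq hX' h1' h2' h1.1 h2.1 hc]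

/-- The shared pencil forces `H = H'`. Any two images in `H` are collinear, whereas a star and a top
through a common pencil contain members that are not adjacent; reflection of adjacency gives the
contradiction. -/
theorem not_commonSup_both (hE : GrassEmb Q n l f) {A C : Submodule F V} (hAC : A ≤ C)
    (hA : finrank F A + 1 = l) (hC : finrank F C = l + 1) {H H' : Submodule F W}
    (hH : CommonSup Q n f (grassStar l A) H) : ¬ CommonSup Q n f (grassTop l C) H' := by
  intro hH'
  have hl := hE.le_finrank
  have hl2 := hE.two_le
  obtain ⟨B, B', h1, h1', h2, h2', hne⟩ := exists_pencil hAC hA hC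
  have hc := finrank_inf_of_star hA h1 h2 hne
  have hHH : H = H' := by
    rw [← hE.sup_eq hH h1 h2 h1.1 h2.1 hc, hE.sup_eq hH' h1' h2' h1.1 h2.1 hc]
  subst hHH
  obtain ⟨D, hD, hDC⟩ := exists_star_not_le hAC hA (show finrank F C < finrank F V by omega)
  obtain ⟨E, -, hEC, dE, hAE⟩ := exists_between_finrank_eq_not_le (bot_le : ⊥ ≤ C) (B := A)
    (k := l) (bot_lt_iff_ne_bot.2 (by rintro rfl; rw [finrank_bot] at hA; omega)) (by simp)
    (by omega)
  -- `D` is in the star but not in `C`, and `E` is in the top but does not contain `A`. Adjacency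
  -- would make `D ⊓ E` equal to `D ⊓ C = A`, hence `A ≤ E`.
  have hDE : D ≠ E := fun h => hAE (h ▸ hD.2)
  have hle : f D ⊔ f E ≤ H := sup_le (hH.2.2 _ hD) (hH'.2.2 _ ⟨dE, hEC⟩)
  have hfne : f D ≠ f E := fun h => hDE (hE.inj _ _ hD.1 dE h)
  have d1 := hE.dim D hD.1
  have d2 := hE.dim E dE
  have d3 := finrank_inf_lt hfne (by omega)
  have d4 := finrank_sup_add_inf (f D) (f E)
  have d5 := Submodule.finrank_mono hle
  have d6 := hH.1
  have hadj := hE.coll_rev D E hD.1 dE (hH.2.1.mono hle) (by omega)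
  have hDCA : A = D ⊓ C := by
    apply Submodule.eq_of_le_of_finrank_le (le_inf hD.2 hAC)
    have : D ⊓ C ≠ D := fun h => hDC (inf_eq_left.1 h)
    have := Submodule.finrank_lt_finrank_of_lt (lt_of_le_of_ne inf_le_left this)
    have := hD.1
    omega
  have h7 : D ⊓ E ≤ A := hDCA ▸ le_inf inf_le_left (inf_le_right.trans hEC)
  have h8 : D ⊓ E = A := Submodule.eq_of_le_of_finrank_eq h7 (by omega)
  exact hAE (h8 ▸ inf_le_right)

/-- Adjacent tops have the same kind. -/
theorem commonSub_top_of_adjacent (hE : GrassEmb Q n l f) {C C' : Submodule F V}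
    (hC : finrank F C = l + 1) (hC' : finrank F C' = l + 1)
    (hadj : finrank F (C ⊓ C' : Submodule F V) + 1 = l + 1)
    (h : ∃ X, CommonSub n f (grassTop l C) X) : ∃ X, CommonSub n f (grassTop l C') X := by
  have hl2 := hE.two_le
  obtain ⟨X, hX⟩ := h
  refine (hE.top_type hC').resolve_right ?_
  rintro ⟨H, hH⟩
  set B := C ⊓ C' with hBdef
  have dB : finrank F B = l := by omega
  have hBC : B ≤ C := inf_le_left
  have hBC' : B ≤ C' := inf_le_right
  obtain ⟨A, hAB, hA⟩ := exists_finrank_eq_of_le B (k := l - 1) (by omega)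
  replace hA : finrank F A + 1 = l := by omega
  obtain ⟨A', -, hAB', hA', hAA'⟩ := exists_between_finrank_eq_not_le (bot_le : ⊥ ≤ B) (B := A)
    (k := l - 1) (bot_lt_iff_ne_bot.2 (by rintro rfl; rw [finrank_bot] at hA; omega)) (by simp)
    (by omega)
  replace hA' : finrank F A' + 1 = l := by omega
  -- The star of `A` shares a pencil with the top of `C'`, which is of the second kind, so it is of
  -- the first kind; its common subspace is `X` because it also shares a pencil with the top of `C`.
  have hXA : CommonSub n f (grassStar l A) X := by
    rcases hE.star_type hA with ⟨X', hX'⟩ | ⟨H', hH'⟩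
    · exact hE.commonSub_unique (hAB.trans hBC) hA hC hX' hX ▸ hX'
    · exact (hE.not_commonSup_both (hAB.trans hBC') hA hC' hH' hH).elim
  have hBA : B ∈ grassStar l A := ⟨dB, hAB⟩
  have hBA' : B ∈ grassStar l A' := ⟨dB, hAB'⟩
  have hBtC : B ∈ grassTop l C := ⟨dB, hBC⟩
  have hBtC' : B ∈ grassTop l C' := ⟨dB, hBC'⟩
  obtain ⟨B₂, b2, b2', n2⟩ := exists_pencil_ne hAB hBC' hA dB hC'
  obtain ⟨D₁, d1, d1', m1⟩ := exists_pencil_ne hAB' hBC hA' dB hC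
  obtain ⟨D₂, d2, d2', m2⟩ := exists_pencil_ne hAB' hBC' hA' dB hC'
  have c2 := finrank_inf_of_star hA hBA b2 n2
  have e1 := finrank_inf_of_star hA' hBA' d1 m1
  have e2 := finrank_inf_of_star hA' hBA' d2 m2
  have hline : f B ⊓ f B₂ = X := hE.inf_eq hXA hBA b2 dB b2.1 c2
  have hline' : f B ⊔ f B₂ = H := hE.sup_eq hH hBtC' b2' dB b2.1 c2
  -- The pencil of `A ≤ C'` is the full line between `X` and `H`. Whichever kind the star of `A'`
  -- has, a pencil through `A'` yields another point of that line: `D₂` from `C'` if the star is of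
  -- the first kind, `D₁` from `C` otherwise. But `D₂` does not contain `A`, and `D₁` does not lie
  -- in `C'`.
  rcases hE.star_type hA' with ⟨X', hX'⟩ | ⟨H', hH'⟩
  · have hXX : X' = X := by
      rw [← hE.inf_eq hX' hBA' d1 dB d1.1 e1, hE.inf_eq hX hBtC d1' dB d1.1 e1]
    subst hXX
    have := (hE.mem_line dB b2.1 d2.1 c2 (hline ▸ hX'.2 _ d2) (hline' ▸ hH.2.2 _ d2')).1
    rw [inf_eq_of_star hA hBA b2 n2] at this
    have hle : A ≤ B ⊓ D₂ := le_inf hAB this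
    rw [inf_eq_of_star hA' hBA' d2 m2] at hle
    exact hAA' hle
  · have hHH : H' = H := by
      rw [← hE.sup_eq hH' hBA' d2 dB d2.1 e2, hE.sup_eq hH hBtC' d2' dB d2.1 e2]
    subst hHH
    have := (hE.mem_line dB b2.1 d1.1 c2 (hline ▸ hX.2 _ d1') (hline' ▸ hH'.2.2 _ d1)).2
    rw [sup_eq_of_top hC' hBtC' b2' n2] at this
    have hle : D₁ ≤ B := le_inf d1'.2 this
    exact m1 (Submodule.eq_of_le_of_finrank_eq hle (d1.1.trans dB.symm)).symm

theorem commonSub_top_of_commonSub_top (hE : GrassEmb Q n l f) {C C' : Submodule F V}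
    (hC : finrank F C = l + 1) (hC' : finrank F C' = l + 1)
    (hcommon : ∃ X, CommonSub n f (grassTop l C) X) : ∃ X, CommonSub n f (grassTop l C') X :=
  grassmannian_connected (p := fun C => ∃ X, CommonSub n f (grassTop l C) X)
    (fun _ _ h1 h2 h3 => hE.commonSub_top_of_adjacent h1 h2 h3) hC hC' hcommon

/-- A star of the first kind spans a totally singular `n`-space, and the points between the
common subspace and a subspace spanned by three members come from the star. -/
theorem plane_of_commonSub_star (hQ : IsHyperbolicForm Q n) (hE : GrassEmb Q n l f)
    {A : Submodule F V} (hA : finrank F A + 1 = l) {X : Submodule F W}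
    (hX : CommonSub n f (grassStar l A) X) {B₁ B₂ B₃ : Submodule F V} (h₁ : B₁ ∈ grassStar l A)
    (h₂ : B₂ ∈ grassStar l A) (h₃ : B₃ ∈ grassStar l A) (h12 : B₁ ≠ B₂) (h3 : ¬ B₃ ≤ B₁ ⊔ B₂) :
    IsTotSingular Q (f B₁ ⊔ f B₂ ⊔ f B₃) ∧ finrank F (f B₁ ⊔ f B₂ ⊔ f B₃ : Submodule F W) = n ∧
      ∀ P : Submodule F W, finrank F P + 2 = n → X ≤ P → P ≤ f B₁ ⊔ f B₂ ⊔ f B₃ →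
        ∃ B ∈ grassStar l A, B ≤ B₁ ⊔ B₂ ⊔ B₃ ∧ f B = P := by
  have h13 : B₁ ≠ B₃ := fun h => h3 (h ▸ le_sup_left)
  have h23 : B₂ ≠ B₃ := fun h => h3 (h ▸ le_sup_right)
  have c12 := finrank_inf_of_star hA h₁ h₂ h12
  have c13 := finrank_inf_of_star hA h₁ h₃ h13
  have c23 := finrank_inf_of_star hA h₂ h₃ h23
  obtain ⟨t12, s12⟩ := hE.coll _ _ h₁.1 h₂.1 c12
  obtain ⟨t13, s13⟩ := hE.coll _ _ h₁.1 h₃.1 c13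
  obtain ⟨t23, s23⟩ := hE.coll _ _ h₂.1 h₃.1 c23
  have hts := t12.sup_sup t13 t23
  have hf3 : ¬ f B₃ ≤ f B₁ ⊔ f B₂ := fun h => h3 (hE.mem_line h₁.1 h₂.1 h₃.1 c12
    (by rw [hE.inf_eq hX h₁ h₂ h₁.1 h₂.1 c12]; exact hX.2 _ h₃) h).2
  have hM : finrank F (f B₁ ⊔ f B₂ ⊔ f B₃ : Submodule F W) = n := by
    have := hQ.finrank_le hts
    have := Submodule.finrank_lt_finrank_of_lt (left_lt_sup.2 hf3)
    omega
  refine ⟨hts, hM, fun P hP hXP hPM => ?_⟩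
  have hXd := hX.1
  have hle : B₁ ≤ B₁ ⊔ B₂ ⊔ B₃ := le_sup_left.trans le_sup_left
  by_cases hP1 : f B₁ = P
  · exact ⟨B₁, h₁, hle, hP1⟩
  have d1 := hE.dim _ h₁.1
  have hf1 : ¬ f B₁ ≤ f B₂ ⊔ f B₃ := fun h => by
    rw [sup_assoc, sup_eq_right.2 h] at hM
    omega
  set K := f B₁ ⊔ P with hK
  have dK : finrank F K + 1 = n := by
    have a1 := finrank_inf_lt hP1 (by omega)
    have a2 := Submodule.finrank_mono (le_inf (hX.2 _ h₁) hXP)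
    have a3 := finrank_sup_add_inf (f B₁) P
    rw [← hK] at a3
    omega
  -- In the projective plane of the span modulo `X`, the line joining `f B₁` to `P` meets the line
  -- joining `f B₂` to `f B₃`. The meeting point `R` is an image because it lies on the second line,
  -- and then `P` is one because it lies on the line through `f B₁` and `R`.
  have hdim : n ≤ finrank F (K ⊓ (f B₂ ⊔ f B₃) : Submodule F W) + 2 := by
    have a1 := finrank_sup_add_inf K (f B₂ ⊔ f B₃)
    have a2 := Submodule.finrank_mono (show K ⊔ (f B₂ ⊔ f B₃) ≤ f B₁ ⊔ f B₂ ⊔ f B₃ from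
      sup_le (sup_le (le_sup_left.trans le_sup_left) hPM)
        (sup_le (le_sup_right.trans le_sup_left) le_sup_right))
    omega
  obtain ⟨R, hXR, hRK, dR⟩ := exists_between_finrank_eq (U := X) (T := K ⊓ (f B₂ ⊔ f B₃))
    (k := n - 2) (le_inf (hXP.trans le_sup_right) ((hX.2 _ h₂).trans le_sup_left))
    (by omega) (by omega)
  obtain ⟨B₅, d5, hAB5, h5, rfl⟩ := hE.line _ _ h₂.1 h₃.1 c23 R (by omega)
    (by rwa [hE.inf_eq hX h₂ h₃ h₂.1 h₃.1 c23]) (hRK.trans inf_le_right)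
  rw [inf_eq_of_star hA h₂ h₃ h23] at hAB5
  have h₅ : B₅ ∈ grassStar l A := ⟨d5, hAB5⟩
  have h15 : B₁ ≠ B₅ := fun h => hf1 (h ▸ hRK.trans inf_le_right)
  have c15 := finrank_inf_of_star hA h₁ h₅ h15
  have e15 : f B₁ ⊔ f B₅ = K := sup_eq_of_finrank le_sup_left (hRK.trans inf_le_left) (by
    have := (hE.coll _ _ h₁.1 d5 c15).2
    omega)
  obtain ⟨B₆, d6, hAB6, h6, rfl⟩ := hE.line _ _ h₁.1 d5 c15 P hP
    (by rwa [hE.inf_eq hX h₁ h₅ h₁.1 d5 c15]) (e15 ▸ le_sup_right)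
  rw [inf_eq_of_star hA h₁ h₅ h15] at hAB6
  exact ⟨B₆, ⟨d6, hAB6⟩, h6.trans (sup_le hle (h5.trans
    (sup_le (le_sup_right.trans le_sup_left) le_sup_right))), rfl⟩

/-- The image of a star of the first kind. -/
theorem exists_of_commonSub_star (hQ : IsHyperbolicForm Q n) (hE : GrassEmb Q n l f)
    {A : Submodule F V} (hA : finrank F A + 1 = l) {X : Submodule F W}
    (hX : CommonSub n f (grassStar l A) X) :
    finrank F V = l + 2 ∧ ∃ M : Submodule F W, IsTotSingular Q M ∧ finrank F M = n ∧
      (∀ B ∈ grassStar l A, f B ≤ M) ∧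
      ∀ P : Submodule F W, finrank F P + 2 = n → X ≤ P → P ≤ M → ∃ B ∈ grassStar l A, f B = P := by
  have hl := hE.le_finrank
  obtain ⟨C, hAC, -, hC⟩ := exists_between_finrank_eq (le_top : A ≤ ⊤) (k := l + 1) (by omega)
    (by rw [finrank_top]; omega)
  obtain ⟨B₁, B₂, h₁, h1', h₂, h2', h12⟩ := exists_pencil hAC hA hC
  have e12 := sup_eq_of_top hC h1' h2' h12
  obtain ⟨B₃, h₃, h3C⟩ := exists_star_not_le hAC hA (show finrank F C < finrank F V by omega)
  obtain ⟨hts, hM, hplane⟩ := plane_of_commonSub_star hQ hE hA hX h₁ h₂ h₃ h12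
    (e12 ▸ h3C)
  -- Members of a star have mutually orthogonal images, and a maximal totally singular space is its
  -- own perp.
  have hall : ∀ B ∈ grassStar l A, f B ≤ f B₁ ⊔ f B₂ ⊔ f B₃ := by
    intro B hB
    have hperp : ∀ B' ∈ grassStar l A, f B ≤ polarPerp Q (f B') := fun B' hB' => by
      have hts : IsTotSingular Q (f B' ⊔ f B) := by
        by_cases hne : B' = B
        · rw [hne, sup_idem]
          exact hE.ts _ hB.1
        · exact (hE.coll _ _ hB'.1 hB.1 (finrank_inf_of_star hA hB' hB hne)).1
      exact le_sup_right.trans (hts.le_polarPerp.trans (fun z hz => mem_polarPerp.2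
        fun y hy => mem_polarPerp.1 hz y (Submodule.mem_sup_left hy)))
    rw [← hQ.polarPerp_eq_self hts hM, polarPerp_sup, polarPerp_sup]
    exact le_inf (le_inf (hperp _ h₁) (hperp _ h₂)) (hperp _ h₃)
  refine ⟨?_, _, hts, hM, hall, fun P hP hXP hPM => ?_⟩
  -- All images of the star lie in the plane, whose points come from members below `C ⊔ B₃`. By
  -- injectivity every `l`-space through `A` lies there, so `V` is no larger than this `(l +
  -- 2)`-space.
  · have htop : (⊤ : Submodule F V) ≤ C ⊔ B₃ := by
      intro y _
      by_cases hyA : y ∈ A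
      · exact Submodule.mem_sup_left (hAC hyA)
      have hy : A ⊔ F ∙ y ∈ grassStar l A :=
        ⟨by rw [finrank_sup_span_singleton hyA, hA], le_sup_left⟩
      obtain ⟨B, hB, hle, hf⟩ := hplane _ (hE.dim _ hy.1) (hX.2 _ hy) (hall _ hy)
      rw [hE.inj _ _ hB.1 hy.1 hf, e12] at hle
      exact hle (Submodule.mem_sup_right (Submodule.mem_span_singleton_self y))
    have h5 := Submodule.finrank_mono htop
    have h6 := finrank_sup_add_inf C B₃
    have h7 := Submodule.finrank_mono (le_inf hAC h₃.2)
    have h8 := h₃.1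
    rw [finrank_top] at h5
    omega
  · obtain ⟨B, hB, -, hf⟩ := hplane P hP hXP hPM
    exact ⟨B, hB, hf⟩

end GrassEmb

end Grassmannian

/-! ### Duality between stars and tops -/

section Duality

variable {F : Type*} [Field F] {V : Type*} [AddCommGroup V] [Module F V] [FiniteDimensional F V]
  {W : Type*} [AddCommGroup W] [Module F W] {Q : QuadraticForm F W} {n l : ℕ}
  {f : Submodule F V → Submodule F W}

theorem coann_inf (D E : Submodule F (Dual F V)) :
    (D ⊓ E).dualCoannihilator = D.dualCoannihilator ⊔ E.dualCoannihilator := by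
  have h := (Subspace.orderIsoFiniteDimensional (K := F) (V := V)).symm.map_sup
    (OrderDual.toDual D) (OrderDual.toDual E)
  exact h

theorem coann_le_coann {D E : Submodule F (Dual F V)} :
    D.dualCoannihilator ≤ E.dualCoannihilator ↔ E ≤ D :=
  (Subspace.orderIsoFiniteDimensional (K := F) (V := V)).symm.le_iff_le
    (x := OrderDual.toDual D) (y := OrderDual.toDual E)

theorem finrank_coann (D : Submodule F (Dual F V)) :
    finrank F D + finrank F D.dualCoannihilator = finrank F V :=
  Subspace.finrank_add_finrank_dualCoannihilator_eq D

theorem coann_ann (B : Submodule F V) : B.dualAnnihilator.dualCoannihilator = B :=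
  Subspace.dualAnnihilator_dualCoannihilator_eq

theorem finrank_ann (B : Submodule F V) :
    finrank F B.dualAnnihilator + finrank F B = finrank F V := by
  have := finrank_coann B.dualAnnihilator
  rwa [coann_ann] at this

theorem mem_grassTop_ann {A : Submodule F V} (D : Submodule F (Dual F V)) (hl : l ≤ finrank F V) :
    D ∈ grassTop (finrank F V - l) A.dualAnnihilator ↔ D.dualCoannihilator ∈ grassStar l A := by
  have h := finrank_coann D
  have h2 : D ≤ A.dualAnnihilator ↔ A ≤ D.dualCoannihilator := by
    conv_rhs => rw [← coann_ann A]
    exact coann_le_coann.symm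
  simp only [grassTop, grassStar, Set.mem_ofPred_eq, h2]
  exact and_congr_left fun _ => by omega

theorem mem_grassStar_ann {C : Submodule F V} (D : Submodule F (Dual F V))
    (hl : l ≤ finrank F V) :
    D ∈ grassStar (finrank F V - l) C.dualAnnihilator ↔ D.dualCoannihilator ∈ grassTop l C := by
  have h := finrank_coann D
  have h2 : C.dualAnnihilator ≤ D ↔ D.dualCoannihilator ≤ C := by
    conv_rhs => rw [← coann_ann C]
    exact coann_le_coann.symm
  simp only [grassTop, grassStar, Set.mem_ofPred_eq, h2]
  exact and_congr_left fun _ => by omega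

namespace GrassEmb

/-- The dual description of the same set of points. -/
theorem dual (hE : GrassEmb Q n l f) : GrassEmb Q n (finrank F V - l)
    (fun D : Submodule F (Dual F V) => f D.dualCoannihilator) := by
  have hl := hE.two_le
  have hl2 := hE.le_finrank
  have hd : ∀ D : Submodule F (Dual F V), finrank F D = finrank F V - l →
      finrank F D.dualCoannihilator = l := fun D hD => by
    have := finrank_coann D
    omega
  have hi : ∀ D E : Submodule F (Dual F V), finrank F D = finrank F V - l →
      finrank F E = finrank F V - l →
      (finrank F (D ⊓ E : Submodule F (Dual F V)) + 1 = finrank F V - l ↔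
        finrank F (D.dualCoannihilator ⊓ E.dualCoannihilator : Submodule F V) + 1 = l) := by
    intro D E hD hE
    have h1 := finrank_coann (D ⊓ E)
    have h2 := finrank_sup_add_inf D.dualCoannihilator E.dualCoannihilator
    rw [coann_inf] at h1
    rw [hd D hD, hd E hE] at h2
    omega
  refine ⟨by omega, by rw [Subspace.dual_finrank_eq]; omega, fun B hB => hE.ts _ (hd B hB),
    fun B hB => hE.dim _ (hd B hB), fun B B' hB hB' h => ?_,
    fun B B' hB hB' h => hE.coll _ _ (hd B hB) (hd B' hB') ((hi B B' hB hB').1 h),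
    fun B B' hB hB' h h' => (hi B B' hB hB').2 (hE.coll_rev _ _ (hd B hB) (hd B' hB') h h'),
    fun B B' hB hB' h P hP h1 h2 => ?_⟩
  · have := hE.inj _ _ (hd B hB) (hd B' hB') h
    exact le_antisymm (coann_le_coann.1 this.ge) (coann_le_coann.1 this.le)
  · obtain ⟨D, hD, h3, h4, h5⟩ :=
      hE.line _ _ (hd B hB) (hd B' hB') ((hi B B' hB hB').1 h) P hP h1 h2
    refine ⟨D.dualAnnihilator, ?_, ?_, ?_, ?_⟩
    · have := finrank_ann D
      omega
    · rw [← coann_le_coann, coann_ann, coann_inf]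
      exact h4
    · rw [← coann_le_coann, coann_ann, Submodule.dualCoannihilator_sup_eq]
      exact h3
    · simp only [coann_ann]
      exact h5

theorem dual_commonSub_top (hE : GrassEmb Q n l f) {A : Submodule F V} {X : Submodule F W} :
    CommonSub n (fun D : Submodule F (Dual F V) => f D.dualCoannihilator)
      (grassTop (finrank F V - l) A.dualAnnihilator) X ↔ CommonSub n f (grassStar l A) X := by
  have hl : l ≤ finrank F V := by have := hE.le_finrank; omega
  refine and_congr_right fun _ => ⟨fun h B hB => ?_, fun h D hD => h _ ((mem_grassTop_ann D hl).1 hD)⟩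
  have := h B.dualAnnihilator ((mem_grassTop_ann _ hl).2 (by rwa [coann_ann]))
  simpa only [coann_ann] using this

theorem dual_commonSub_star (hE : GrassEmb Q n l f) {C : Submodule F V} {X : Submodule F W} :
    CommonSub n (fun D : Submodule F (Dual F V) => f D.dualCoannihilator)
      (grassStar (finrank F V - l) C.dualAnnihilator) X ↔ CommonSub n f (grassTop l C) X := by
  have hl : l ≤ finrank F V := by have := hE.le_finrank; omega
  refine and_congr_right fun _ =>
    ⟨fun h B hB => ?_, fun h D hD => h _ ((mem_grassStar_ann D hl).1 hD)⟩
  have := h B.dualAnnihilator ((mem_grassStar_ann _ hl).2 (by rwa [coann_ann]))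
  simpa only [coann_ann] using this

theorem dual_commonSup_star (hE : GrassEmb Q n l f) {C : Submodule F V} {H : Submodule F W}
    (h : CommonSup Q n f (grassTop l C) H) :
    CommonSup Q n (fun D : Submodule F (Dual F V) => f D.dualCoannihilator)
      (grassStar (finrank F V - l) C.dualAnnihilator) H := by
  have hl : l ≤ finrank F V := by have := hE.le_finrank; omega
  exact ⟨h.1, h.2.1, fun D hD => h.2.2 _ ((mem_grassStar_ann D hl).1 hD)⟩

variable [FiniteDimensional F W]

/-- Annihilators turn stars into tops, so this is the constancy of the kind of tops for the dual
embedding. -/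
theorem commonSub_star_of_commonSub_star (hE : GrassEmb Q n l f) {A A' : Submodule F V}
    (hA : finrank F A + 1 = l) (hA' : finrank F A' + 1 = l)
    (h : ∃ X, CommonSub n f (grassStar l A) X) : ∃ X, CommonSub n f (grassStar l A') X := by
  obtain ⟨X, hX⟩ := h
  have hl := hE.le_finrank
  have h1 := finrank_ann A
  have h2 := finrank_ann A'
  obtain ⟨X', hX'⟩ := hE.dual.commonSub_top_of_commonSub_top (C := A.dualAnnihilator)
    (C' := A'.dualAnnihilator) (by omega) (by omega) ⟨X, hE.dual_commonSub_top.2 hX⟩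
  exact ⟨X', hE.dual_commonSub_top.1 hX'⟩

/-- Dual of `exists_of_commonSub_star`: applied to `finrank F V - l` in place of `l`, its dimension
formula becomes `l = 2`. -/
theorem exists_of_commonSub_top (hQ : IsHyperbolicForm Q n) (hE : GrassEmb Q n l f)
    {C : Submodule F V} (hC : finrank F C = l + 1) {X : Submodule F W}
    (hX : CommonSub n f (grassTop l C) X) :
    l = 2 ∧ ∃ M : Submodule F W, IsTotSingular Q M ∧ finrank F M = n ∧
      (∀ B ∈ grassTop l C, f B ≤ M) ∧
      ∀ P : Submodule F W, finrank F P + 2 = n → X ≤ P → P ≤ M → ∃ B ∈ grassTop l C, f B = P := by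
  have hl := hE.le_finrank
  have h1 := finrank_ann C
  obtain ⟨hd, M, hM, dM, hle, hall⟩ := exists_of_commonSub_star hQ hE.dual
    (A := C.dualAnnihilator) (by omega) (hE.dual_commonSub_star.2 hX)
  rw [Subspace.dual_finrank_eq] at hd
  refine ⟨by omega, M, hM, dM, fun B hB => ?_, fun P hP hXP hPM => ?_⟩
  · have := hle B.dualAnnihilator ((mem_grassStar_ann _ (by omega)).2 (by rwa [coann_ann]))
    simpa only [coann_ann] using this
  · obtain ⟨D, hD, hf⟩ := hall P hP hXP hPM
    exact ⟨_, (mem_grassStar_ann _ (by omega)).1 hD, hf⟩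

/-- If all images contain a common `(n - 3)`-space, then every totally singular `(n - 2)`-space
containing it is an image. -/
theorem surj_of_forall_le (hQ : IsHyperbolicForm Q n) (hE : GrassEmb Q n l f) {X : Submodule F W}
    (hX : finrank F X + 3 = n) (hle : ∀ B : Submodule F V, finrank F B = l → X ≤ f B)
    {P : Submodule F W} (hP : IsTotSingular Q P) (dP : finrank F P + 2 = n) (hXP : X ≤ P) :
    ∃ B : Submodule F V, finrank F B = l ∧ f B = P := by
  have hl := hE.le_finrank
  obtain ⟨C, -, hC⟩ := exists_finrank_eq_of_le (⊤ : Submodule F V) (k := l + 1)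
    (by rw [finrank_top]; omega)
  obtain ⟨-, M, hM, dM, hCM, hMC⟩ := exists_of_commonSub_top hQ hE hC
    (X := X) ⟨hX, fun B hB => hle B hB.1⟩
  by_cases hPM : P ≤ M
  · obtain ⟨B, hB, hf⟩ := hMC P dP hXP hPM
    exact ⟨B, hB.1, hf⟩
  obtain ⟨hM', dM'⟩ := hQ.sup_inf_polarPerp hP hM dM
  set K := M ⊓ polarPerp Q P with hK
  have hXM : X ≤ M := by
    obtain ⟨B, hBC, hB⟩ := exists_finrank_eq_of_le C (k := l) (by omega)
    exact (hle B hB).trans (hCM B ⟨hB, hBC⟩)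
  have hXK : X ≤ K := le_inf hXM (hXP.trans hP.le_polarPerp)
  -- `P ⊓ K` contains `X` and is proper in `P`, so it has dimension `n - 3`, while `P ⊔ K` has
  -- dimension `n`.
  have dK : finrank F K + 1 = n := by
    have h1 := finrank_sup_add_inf P K
    have h2 := Submodule.finrank_mono (le_inf hXP hXK)
    have h3 : P ⊓ K < P := lt_of_le_of_ne inf_le_left
      fun h => hPM ((inf_eq_left.1 h).trans inf_le_left)
    have h4 := Submodule.finrank_lt_finrank_of_lt h3
    omega
  obtain ⟨P₁, P₂, s1, t1, s2, t2, hne⟩ := exists_pencil (l := n - 2) hXK (by omega) (by omega)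
  have hKM : K ≤ M := inf_le_left
  have hsup := sup_eq_of_top (l := n - 2) (by omega) t1 t2 hne
  obtain ⟨B₁, hB₁, rfl⟩ := hMC P₁ (by have := s1.1; omega) s1.2 (t1.2.trans hKM)
  obtain ⟨B₂, hB₂, rfl⟩ := hMC P₂ (by have := s2.1; omega) s2.2 (t2.2.trans hKM)
  -- The line from `X` to `K` comes from a pencil in `C`; the star through that pencil spans a
  -- second maximal space `M'` above `K`.
  have hA := finrank_inf_of_top hC hB₁ hB₂ (fun h => hne (h ▸ rfl))
  obtain ⟨-, M', hMs, dMs, hAM, hMA⟩ := exists_of_commonSub_star hQ hE hA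
    (X := X) ⟨hX, fun B hB => hle B hB.1⟩
  have hKM' : K ≤ M' := hsup ▸ sup_le (hAM _ ⟨hB₁.1, inf_le_left⟩) (hAM _ ⟨hB₂.1, inf_le_right⟩)
  have hMM : M ≠ M' := by
    rintro rfl
    obtain ⟨D, hD, hDC⟩ := exists_star_not_le (inf_le_left.trans hB₁.2) hA
      (show finrank F C < finrank F V by omega)
    obtain ⟨B, hB, hf⟩ := hMC (f D) (hE.dim D hD.1) (hle D hD.1) (hAM D hD)
    exact hDC (hE.inj B D hB.1 hD.1 hf ▸ hB.2)
  -- Only two maximal spaces contain `K`, so `P ⊔ K` is `M` or `M'`. The first is impossible as `P`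
  -- is not in `M`; in the second, `P` is an image from the star.
  rcases hQ.eq_or_eq_of_le dK hM dM hKM hMs dMs hKM' hM' dM' le_sup_right hMM with h | h
  · exact (hPM (h ▸ le_sup_left)).elim
  · obtain ⟨B, hB, hf⟩ := hMA P dP hXP (h ▸ le_sup_left)
    exact ⟨B, hB.1, hf⟩

end GrassEmb

end Duality

/-! ### Classification of embedded Grassmannians -/

section Classification

variable {F : Type*} [Field F] {V : Type*} [AddCommGroup V] [Module F V] [FiniteDimensional F V]
  {W : Type*} [AddCommGroup W] [Module F W] [FiniteDimensional F W] {Q : QuadraticForm F W}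
  {n l : ℕ} {f : Submodule F V → Submodule F W}

theorem exists_finrank_one_not_le {U : Submodule F V} (hU : finrank F U < finrank F V) :
    ∃ A : Submodule F V, finrank F A = 1 ∧ ¬ A ≤ U ∧
      finrank F (U ⊔ A : Submodule F V) = finrank F U + 1 := by
  have : ¬ (⊤ : Submodule F V) ≤ U := fun h => by
    have := Submodule.finrank_mono h
    rw [finrank_top] at this
    omega
  obtain ⟨x, -, hx⟩ := Set.not_subset.1 this
  refine ⟨F ∙ x, finrank_span_singleton fun h => hx (h ▸ U.zero_mem), ?_,
    finrank_sup_span_singleton hx⟩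
  rwa [Submodule.span_singleton_le_iff_mem]

theorem finrank_sup_of_one {A A' : Submodule F V} (hA : finrank F A = 1) (hA' : finrank F A' = 1)
    (hne : A ≠ A') : finrank F (A ⊔ A' : Submodule F V) = 2 := by
  have h1 := finrank_sup_add_inf A A'
  have h2 := finrank_inf_lt hne (hA.trans hA'.symm)
  omega

/-- A set of hyperplanes of `M` that is closed under pencils consists of all hyperplanes containing
some subspace. -/
theorem exists_forall_hyperplane {M : Submodule F W} (dM : finrank F M = n)
    {𝓗 : Set (Submodule F W)} (hM : ∀ H ∈ 𝓗, H ≤ M) (hd : ∀ H ∈ 𝓗, finrank F H + 1 = n)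
    (hpencil : ∀ H ∈ 𝓗, ∀ H' ∈ 𝓗, H ≠ H' → ∀ G ≤ M, finrank F G + 1 = n → H ⊓ H' ≤ G → G ∈ 𝓗) :
    ∃ X ≤ M, (∀ H ∈ 𝓗, X ≤ H) ∧ ∀ G ≤ M, finrank F G + 1 = n → X ≤ G → G ∈ 𝓗 := by
  -- `M` qualifies vacuously, since no hyperplane contains it. A minimal `X` lies in every `H` of
  -- the family, since otherwise `X ⊓ H` would qualify as well.
  obtain ⟨X, ⟨hXM, hX⟩, hmin⟩ := wellFounded_lt.has_min
    {Y : Submodule F W | Y ≤ M ∧ ∀ G ≤ M, finrank F G + 1 = n → Y ≤ G → G ∈ 𝓗}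
    ⟨M, le_rfl, fun G _ dG hMG => by
      have := Submodule.finrank_mono hMG
      omega⟩
  refine ⟨X, hXM, fun H hH => ?_, hX⟩
  by_contra hXH
  have hlt : X ⊓ H < X := lt_of_le_of_ne inf_le_left fun h => hXH (inf_eq_left.1 h)
  refine hmin (X ⊓ H) ⟨inf_le_left.trans hXM, fun G hG dG hle => ?_⟩ hlt
  by_cases hGH : H = G
  · exact hGH ▸ hH
  have dH := hd H hH
  have b1 := finrank_inf_lt hGH (by omega)
  have b2 := finrank_sup_add_inf H G
  have b3 := Submodule.finrank_mono (sup_le (hM H hH) hG)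
  have b4 := finrank_sup_add_inf X H
  have b5 := Submodule.finrank_mono (sup_le hXM (hM H hH))
  have b6 := Submodule.finrank_lt_finrank_of_lt hlt
  have b7 := finrank_sup_add_inf X (H ⊓ G)
  have e : X ⊓ (H ⊓ G) = X ⊓ H :=
    le_antisymm (inf_le_inf_left _ inf_le_left) (le_inf inf_le_left (le_inf inf_le_right hle))
  rw [e] at b7
  -- This hyperplane belongs to the family because it contains `X`; together with `H` it generates a
  -- pencil that contains `G`.
  have hG' := hX (X ⊔ H ⊓ G) (sup_le hXM (inf_le_right.trans hG)) (by omega) le_sup_left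
  have hne : H ≠ X ⊔ H ⊓ G := fun h => hXH (h ▸ le_sup_left)
  refine hpencil H hH _ hG' hne G hG dG ?_
  have b8 := finrank_inf_lt hne (by omega)
  rw [inf_eq_of_finrank (A := H ⊓ G) inf_le_left le_sup_right (by omega)]
  exact inf_le_right

namespace GrassEmb

/-- The case in which all stars of a line Grassmannian are of the second kind. -/
theorem exists_interval_of_commonSup_star (hE : GrassEmb Q n l f) (hl : l = 2)
    (hstar : ∀ A : Submodule F V, finrank F A = 1 → ∃ H, CommonSup Q n f (grassStar l A) H) :
    ∃ X M : Submodule F W, IsTotSingular Q M ∧ finrank F M = n ∧ X ≤ M ∧ finrank F X + 2 ≤ n ∧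
      ∀ P : Submodule F W, finrank F P + 2 = n →
        ((∃ B : Submodule F V, finrank F B = l ∧ f B = P) ↔ X ≤ P ∧ P ≤ M) := by
  subst hl
  have hV := hE.le_finrank
  choose! H hH using hstar
  have hfle : ∀ A B : Submodule F V, finrank F A = 1 → finrank F B = 2 → A ≤ B → f B ≤ H A :=
    fun A B hA hB hAB => (hH A hA).2.2 B ⟨hB, hAB⟩
  have hdH : ∀ A : Submodule F V, finrank F A = 1 → finrank F (H A) + 1 = n :=
    fun A hA => (hH A hA).1
  -- If `H A = H A'`, then two disjoint 2-spaces through `A` and `A'` (available since `dim V ≥ 4`)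
  -- have images in one `(n - 1)`-space, so reflection of adjacency would make them meet.
  have hHinj : ∀ A A' : Submodule F V, finrank F A = 1 → finrank F A' = 1 → A ≠ A' →
      H A ≠ H A' := by
    intro A A' hA hA' hne heq
    have d := finrank_sup_of_one hA hA' hne
    obtain ⟨A₃, d3, h3, e3⟩ := exists_finrank_one_not_le (U := A ⊔ A') (by omega)
    obtain ⟨A₄, d4, h4, e4⟩ := exists_finrank_one_not_le (U := A ⊔ A' ⊔ A₃) (by omega)
    have dD := finrank_sup_of_one hA d4 fun h => h4 (h ▸ le_sup_left.trans le_sup_left)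
    have dE := finrank_sup_of_one hA' d3 fun h => h3 (h ▸ le_sup_right)
    have h5 := finrank_sup_add_inf (A ⊔ A₄) (A' ⊔ A₃)
    have h6 : A ⊔ A₄ ⊔ (A' ⊔ A₃) = A ⊔ A' ⊔ A₃ ⊔ A₄ := by ac_rfl
    rw [h6] at h5
    have hle : f (A ⊔ A₄) ⊔ f (A' ⊔ A₃) ≤ H A := sup_le (hfle _ _ hA dD le_sup_left)
      (heq ▸ hfle _ _ hA' dE le_sup_left)
    have hne' : f (A ⊔ A₄) ≠ f (A' ⊔ A₃) := fun h => by
      rw [hE.inj _ _ dD dE h, inf_idem] at h5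
      omega
    have f1 := hE.dim _ dD
    have f2 := hE.dim _ dE
    have f3 := finrank_inf_lt hne' (by omega)
    have f4 := finrank_sup_add_inf (f (A ⊔ A₄)) (f (A' ⊔ A₃))
    have f5 := Submodule.finrank_mono hle
    have f6 := hdH A hA
    have := hE.coll_rev _ _ dD dE ((hH A hA).2.1.mono hle) (by omega)
    omega
  have hinf : ∀ A A' : Submodule F V, finrank F A = 1 → finrank F A' = 1 → A ≠ A' →
      H A ⊓ H A' = f (A ⊔ A') := by
    intro A A' hA hA' hne
    have d := finrank_sup_of_one hA hA' hne
    have h1 := hE.dim _ d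
    have h2 := hdH A hA
    have h3 := hdH A' hA'
    have h4 := finrank_inf_lt (hHinj A A' hA hA' hne) (by omega)
    exact inf_eq_of_finrank (hfle _ _ hA d le_sup_left) (hfle _ _ hA' d le_sup_right) (by omega)
  have htriple : ∀ A₁ A₂ A₃ : Submodule F V, finrank F A₁ = 1 → finrank F A₂ = 1 →
      finrank F A₃ = 1 → A₁ ≠ A₂ → ¬ A₃ ≤ A₁ ⊔ A₂ →
      finrank F (A₁ ⊔ A₃ : Submodule F V) = 2 ∧ finrank F (A₂ ⊔ A₃ : Submodule F V) = 2 ∧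
      finrank F ((A₁ ⊔ A₃) ⊓ (A₂ ⊔ A₃) : Submodule F V) + 1 = 2 ∧
      f (A₁ ⊔ A₃) ⊔ f (A₂ ⊔ A₃) = H A₃ := by
    intro A₁ A₂ A₃ d1 d2 d3 h12 h3
    have e1 := finrank_sup_of_one d1 d3 fun h => h3 (h ▸ le_sup_left)
    have e2 := finrank_sup_of_one d2 d3 fun h => h3 (h ▸ le_sup_right)
    have hne : A₁ ⊔ A₃ ≠ A₂ ⊔ A₃ := fun h => h3 (by
      have hle : A₁ ⊔ A₂ ≤ A₁ ⊔ A₃ := sup_le le_sup_left (h ▸ le_sup_left)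
      rw [Submodule.eq_of_le_of_finrank_eq hle
        ((finrank_sup_of_one d1 d2 h12).trans e1.symm)]
      exact le_sup_right)
    have m1 : A₁ ⊔ A₃ ∈ grassStar 2 A₃ := ⟨e1, le_sup_right⟩
    have m2 : A₂ ⊔ A₃ ∈ grassStar 2 A₃ := ⟨e2, le_sup_right⟩
    have c := finrank_inf_of_star (by omega) m1 m2 hne
    exact ⟨e1, e2, c, hE.sup_eq (hH A₃ d3) m1 m2 e1 e2 c⟩
  obtain ⟨A₁, d1, -, -⟩ := exists_finrank_one_not_le (U := (⊥ : Submodule F V))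
    (by rw [finrank_bot]; omega)
  obtain ⟨A₂, d2, h2, -⟩ := exists_finrank_one_not_le (U := A₁) (by omega)
  have h12 : A₁ ≠ A₂ := fun h => h2 h.ge
  have d12 := finrank_sup_of_one d1 d2 h12
  obtain ⟨A₃, d3, h3, -⟩ := exists_finrank_one_not_le (U := A₁ ⊔ A₂) (by omega)
  obtain ⟨d13, d23, c3, s3⟩ := htriple A₁ A₂ A₃ d1 d2 d3 h12 h3
  have hn := hE.dim _ d12
  set 𝓗 : Set (Submodule F W) := H '' {A | finrank F A = 1} with h𝓗
  have hd𝓗 : ∀ G ∈ 𝓗, finrank F G + 1 = n := by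
    rintro _ ⟨A, hA, rfl⟩
    exact hdH A hA
  have k₁ : ∀ G ∈ 𝓗, finrank F G = n - 2 + 1 := fun G hG => by
    have := hd𝓗 G hG
    omega
  have k₂ : ∀ G ∈ 𝓗, ∀ G' ∈ 𝓗, G ≠ G' → finrank F (G ⊓ G' : Submodule F W) = n - 2 := by
    rintro _ ⟨A, hA, rfl⟩ _ ⟨A', hA', rfl⟩ hne
    have hAA : A ≠ A' := fun h => hne (h ▸ rfl)
    have := hE.dim _ (finrank_sup_of_one hA hA' hAA)
    rw [hinf A A' hA hA' hAA]
    omega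
  rcases common_subspace_or_superspace k₁ k₂ ⟨_, ⟨A₁, d1, rfl⟩, _, ⟨A₂, d2, rfl⟩,
    hHinj _ _ d1 d2 h12⟩ with ⟨X, dX, hX⟩ | ⟨M, dM, hM⟩
  · exfalso
    have hXeq : ∀ A A' : Submodule F V, finrank F A = 1 → finrank F A' = 1 → A ≠ A' →
        f (A ⊔ A') = X := by
      intro A A' hA hA' hne
      have h1 := hE.dim _ (finrank_sup_of_one hA hA' hne)
      rw [← hinf A A' hA hA' hne] at h1 ⊢
      exact inf_eq_of_finrank (hX _ ⟨A, hA, rfl⟩) (hX _ ⟨A', hA', rfl⟩) (by omega)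
    have h13 : A₁ ≠ A₃ := fun h => h3 (h ▸ le_sup_left)
    have := hE.inj _ _ d12 d13 ((hXeq _ _ d1 d2 h12).trans (hXeq _ _ d1 d3 h13).symm)
    exact h3 (this ▸ le_sup_right)
  replace dM : finrank F M = n := by omega
  -- `M` is spanned by the images of the three sides of a triangle in `V`, which are pairwise
  -- collinear.
  have hMts : IsTotSingular Q M := by
    have h13 : A₁ ≠ A₃ := fun h => h3 (h ▸ le_sup_left)
    have h23 : A₂ ≠ A₃ := fun h => h3 (h ▸ le_sup_right)
    have n12 : A₁ ⊔ A₃ ≠ A₁ ⊔ A₂ := fun h => h3 (h ▸ le_sup_right)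
    have n22 : A₂ ⊔ A₃ ≠ A₁ ⊔ A₂ := fun h => h3 (h ▸ le_sup_right)
    have c1 := finrank_inf_of_star (A := A₁) (l := 2) (by omega) ⟨d13, le_sup_left⟩
      ⟨d12, le_sup_left⟩ n12
    have c2 := finrank_inf_of_star (A := A₂) (l := 2) (by omega) ⟨d23, le_sup_left⟩
      ⟨d12, le_sup_right⟩ n22
    have hts := (hE.coll _ _ d13 d23 c3).1.sup_sup (hE.coll _ _ d13 d12 c1).1
      (hE.coll _ _ d23 d12 c2).1
    rw [s3] at hts
    have hnot : ¬ f (A₁ ⊔ A₂) ≤ H A₃ := by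
      intro h
      have hle : f (A₁ ⊔ A₂) ≤ f (A₁ ⊔ A₃) := by
        rw [← hinf A₁ A₃ d1 d3 h13]
        exact le_inf (hfle _ _ d1 d12 le_sup_left) h
      have := hE.dim _ d13
      exact n12 (hE.inj _ _ d12 d13 (Submodule.eq_of_le_of_finrank_eq hle (by omega))).symm
    have hlt := Submodule.finrank_lt_finrank_of_lt (left_lt_sup.2 hnot)
    have := hdH A₃ d3
    have e := sup_eq_of_finrank (hM _ ⟨A₃, d3, rfl⟩)
      ((hfle _ _ d1 d12 le_sup_left).trans (hM _ ⟨A₁, d1, rfl⟩)) (by omega)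
    exact e ▸ hts
  -- Choose `A₃` off `A₁ ⊔ A₂`. If `R ≠ H A₃`, then `R ⊓ H A₃` is a point of the line joining `f (A₁
  -- ⊔ A₃)` and `f (A₂ ⊔ A₃)`, hence some `f D`. In the plane of the triangle, `D` meets `A₁ ⊔ A₂`
  -- in a 1-space `A₄`, and both `R` and `H A₄` are spanned by `f D` and `f (A₁ ⊔ A₂)`.
  have hpencil : ∀ G ∈ 𝓗, ∀ G' ∈ 𝓗, G ≠ G' → ∀ R ≤ M, finrank F R + 1 = n → G ⊓ G' ≤ R →
      R ∈ 𝓗 := by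
    clear! A₁ A₂ A₃
    rintro _ ⟨A₁, d1, rfl⟩ _ ⟨A₂, d2, rfl⟩ hne R hRM dR hR
    replace d1 : finrank F A₁ = 1 := d1
    replace d2 : finrank F A₂ = 1 := d2
    have h12 : A₁ ≠ A₂ := fun h => hne (h ▸ rfl)
    have d12 := finrank_sup_of_one d1 d2 h12
    obtain ⟨A₃, d3, h3, e3⟩ := exists_finrank_one_not_le (U := A₁ ⊔ A₂) (by omega)
    obtain ⟨d13, d23, c3, s3⟩ := htriple A₁ A₂ A₃ d1 d2 d3 h12 h3
    by_cases hR3 : R = H A₃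
    · exact ⟨A₃, d3, hR3.symm⟩
    have h13 : A₁ ≠ A₃ := fun h => h3 (h ▸ le_sup_left)
    have h23 : A₂ ≠ A₃ := fun h => h3 (h ▸ le_sup_right)
    have dH3 := hdH A₃ d3
    have g1 := finrank_inf_lt hR3 (by omega)
    have g2 := finrank_sup_add_inf R (H A₃)
    have g3 := Submodule.finrank_mono (sup_le hRM (hM _ ⟨A₃, d3, rfl⟩))
    have hL : f (A₁ ⊔ A₃) ⊓ f (A₂ ⊔ A₃) ≤ R ⊓ H A₃ := by
      rw [← hinf A₁ A₃ d1 d3 h13, ← hinf A₂ A₃ d2 d3 h23]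
      exact le_inf ((inf_le_inf inf_le_left inf_le_left).trans hR) (inf_le_left.trans inf_le_right)
    obtain ⟨D, dD, hD1, hD2, hfD⟩ := hE.line _ _ d13 d23 c3 (R ⊓ H A₃) (by omega) hL
      (s3 ▸ inf_le_right)
    have hA3D : A₃ ≤ D := (le_inf le_sup_right le_sup_right).trans hD1
    have hneD : D ≠ A₁ ⊔ A₂ := fun h => h3 (h ▸ hA3D)
    have g4 := finrank_inf_lt hneD (by omega)
    have g5 := finrank_sup_add_inf D (A₁ ⊔ A₂)
    have g6 := Submodule.finrank_mono (show D ⊔ (A₁ ⊔ A₂) ≤ A₁ ⊔ A₂ ⊔ A₃ from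
      sup_le (hD2.trans (sup_le (sup_le_sup_right le_sup_left _)
        (sup_le_sup_right le_sup_right _))) le_sup_left)
    have d4 : finrank F (D ⊓ (A₁ ⊔ A₂) : Submodule F V) = 1 := by omega
    have g7 := hfle _ _ d4 dD inf_le_left
    have g8 := hfle _ _ d4 d12 inf_le_right
    have g9 : f D ≤ R := hfD ▸ inf_le_left
    have g10 : f (A₁ ⊔ A₂) ≤ R := hinf A₁ A₂ d1 d2 h12 ▸ hR
    have g11 := finrank_inf_lt (fun h => hneD (hE.inj _ _ dD d12 h))
      (by have := hE.dim _ dD; have := hE.dim _ d12; omega)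
    have g12 := finrank_sup_add_inf (f D) (f (A₁ ⊔ A₂))
    have g13 := hE.dim _ dD
    have g14 := hE.dim _ d12
    have g15 := hdH _ d4
    refine ⟨_, d4, ?_⟩
    rw [← sup_eq_of_finrank g7 g8 (by omega), ← sup_eq_of_finrank g9 g10 (by omega)]
  obtain ⟨X, hXM, hX, hall⟩ := exists_forall_hyperplane dM hM hd𝓗 hpencil
  have himage : ∀ B : Submodule F V, finrank F B = 2 → X ≤ f B ∧ f B ≤ M := by
    intro B hB
    obtain ⟨A, A', -, hA, -, hA', hne⟩ := exists_pencil (l := 1) (bot_le : ⊥ ≤ B) (by simp) hB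
    rw [← sup_eq_of_top hB hA hA' hne, ← hinf A A' hA.1 hA'.1 hne]
    exact ⟨le_inf (hX _ ⟨A, hA.1, rfl⟩) (hX _ ⟨A', hA'.1, rfl⟩),
      inf_le_left.trans (hM _ ⟨A, hA.1, rfl⟩)⟩
  refine ⟨X, M, hMts, dM, hXM, ?_, fun P dP => ⟨?_, fun ⟨hXP, hPM⟩ => ?_⟩⟩
  · have := Submodule.finrank_mono (himage _ d12).1
    omega
  · rintro ⟨B, hB, rfl⟩
    exact himage B hB
  -- `P` is the intersection of two hyperplanes of `M` above `X`. These are `H A` and `H A'`, so `P`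
  -- is the image of `A ⊔ A'`.
  · obtain ⟨G, G', hG, hG', hK, hK', hne⟩ := exists_pencil (l := n - 1) hPM (by omega) (by omega)
    have hPG := inf_eq_of_star (by omega) hG hK hne
    obtain ⟨A, hA, rfl⟩ := hall G hG'.2 (by have := hG.1; omega) (hXP.trans hG.2)
    obtain ⟨A', hA', rfl⟩ := hall G' hK'.2 (by have := hK.1; omega) (hXP.trans hK.2)
    have hAA : A ≠ A' := fun h => hne (h ▸ rfl)
    exact ⟨A ⊔ A', finrank_sup_of_one hA hA' hAA, hPG ▸ (hinf A A' hA hA' hAA).symm⟩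

theorem classification (hQ : IsHyperbolicForm Q n) (hE : GrassEmb Q n l f) :
    (l = 2 ∨ l + 2 = finrank F V) ∧
    ((∃ X M : Submodule F W, IsTotSingular Q M ∧ finrank F M = n ∧ X ≤ M ∧
        finrank F X + 2 ≤ n ∧ ∀ P : Submodule F W, finrank F P + 2 = n →
          ((∃ B : Submodule F V, finrank F B = l ∧ f B = P) ↔ X ≤ P ∧ P ≤ M)) ∨
      (finrank F V = 4 ∧ ∃ X : Submodule F W, IsTotSingular Q X ∧ finrank F X + 3 = n ∧
        ∀ P : Submodule F W, IsTotSingular Q P → finrank F P + 2 = n →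
          ((∃ B : Submodule F V, finrank F B = l ∧ f B = P) ↔ X ≤ P))) := by
  have hl := hE.two_le
  have hV := hE.le_finrank
  obtain ⟨C, -, hC⟩ := exists_finrank_eq_of_le (⊤ : Submodule F V) (k := l + 1)
    (by rw [finrank_top]; omega)
  obtain ⟨A, hAC, hA⟩ := exists_finrank_eq_of_le C (k := l - 1) (by omega)
  replace hA : finrank F A + 1 = l := by omega
  by_cases htop : ∃ X, CommonSub n f (grassTop l C) X
  · obtain ⟨X, hX⟩ := htop
    have hl2 := (exists_of_commonSub_top hQ hE hC hX).1
    refine ⟨Or.inl hl2, ?_⟩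
    by_cases hstar : ∃ X, CommonSub n f (grassStar l A) X
    · right
      obtain ⟨X, hX⟩ := hstar
      have hfour := (exists_of_commonSub_star hQ hE hA hX).1
      -- For adjacent `A` and `A'`, a top through both shares its common subspace with each of the
      -- two stars; connectedness then makes `X` global.
      have hconst : ∀ A' : Submodule F V, finrank F A' + 1 = l →
          CommonSub n f (grassStar l A') X := by
        intro A' hA'
        refine grassmannian_connected (k := l - 1) (p := fun A => CommonSub n f (grassStar l A) X)
          (fun A A' dA dA' hadj hX => ?_) (by omega) (by omega) hX
        have h1 := finrank_sup_add_inf A A'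
        obtain ⟨C', hle, -, hC'⟩ := exists_between_finrank_eq (le_top : A ⊔ A' ≤ ⊤) (k := l + 1)
          (by omega) (by rw [finrank_top]; omega)
        obtain ⟨Y, hY⟩ := hE.commonSub_top_of_commonSub_top hC hC' ⟨_, ‹_›⟩
        obtain ⟨Z, hZ⟩ := hE.commonSub_star_of_commonSub_star (A' := A') hA (by omega) ⟨_, ‹_›⟩
        have e1 := hE.commonSub_unique (le_sup_left.trans hle) (by omega) hC' hX hY
        have e2 := hE.commonSub_unique (le_sup_right.trans hle) (by omega) hC' hZ hY
        exact e1.trans e2.symm ▸ hZ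
      have hle : ∀ B : Submodule F V, finrank F B = l → X ≤ f B := fun B hB => by
        obtain ⟨A', hA'B, hA'⟩ := exists_finrank_eq_of_le B (k := l - 1) (by omega)
        exact (hconst A' (by omega)).2 B ⟨hB, hA'B⟩
      obtain ⟨B, -, hB⟩ := exists_finrank_eq_of_le C (k := l) (by omega)
      refine ⟨by omega, X, (hE.ts B hB).mono (hle B hB), hX.1, fun P hP dP => ⟨?_, fun hXP => ?_⟩⟩
      · rintro ⟨B, hB, rfl⟩
        exact hle B hB
      · exact surj_of_forall_le hQ hE hX.1 hle hP dP hXP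
    · left
      refine hE.exists_interval_of_commonSup_star hl2 fun A' hA' =>
        (hE.star_type (A := A') (by omega)).resolve_left fun h =>
          hstar (hE.commonSub_star_of_commonSub_star (by omega) hA h)
  · have hsup : ∀ C' : Submodule F V, finrank F C' = l + 1 →
        ∃ H, CommonSup Q n f (grassTop l C') H := fun C' hC' =>
      (hE.top_type hC').resolve_left fun h => htop (hE.commonSub_top_of_commonSub_top hC' hC h)
    have hd : l + 2 = finrank F V := by
      rcases hE.star_type hA with ⟨X, hX⟩ | ⟨H, hH⟩
      · exact (exists_of_commonSub_star hQ hE hA hX).1.symm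
      · obtain ⟨H', hH'⟩ := hsup C hC
        exact (hE.not_commonSup_both hAC hA hC hH hH').elim
    refine ⟨Or.inr hd, Or.inl ?_⟩
    -- In the dual embedding the parameter `finrank F V - l` is 2 and the stars, which come from the
    -- tops, are of the second kind.
    obtain ⟨X, M, hM, dM, hXM, dX, h⟩ := hE.dual.exists_interval_of_commonSup_star (by omega)
      fun D hD => by
        have h1 := finrank_coann D
        obtain ⟨H, hH⟩ := hsup D.dualCoannihilator (by omega)
        have := hE.dual_commonSup_star hH
        rw [Subspace.dualCoannihilator_dualAnnihilator_eq] at this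
        exact ⟨H, this⟩
    refine ⟨X, M, hM, dM, hXM, dX, fun P dP => (Iff.trans ?_ (h P dP))⟩
    constructor
    · rintro ⟨B, hB, rfl⟩
      have := finrank_ann B
      exact ⟨B.dualAnnihilator, by omega, by simp only [coann_ann]⟩
    · rintro ⟨D, hD, rfl⟩
      have := finrank_coann D
      exact ⟨_, by omega, rfl⟩

end GrassEmb

end Classification

/-! ### From the isomorphism to the embedding, and shadows of flags -/

section Isomorphism

variable {F : Type*} [Field F] {W : Type*} [AddCommGroup W] [Module F W] {Q : QuadraticForm F W}
  {n m l : ℕ}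

/-- An isomorphism from a subspace onto the Grassmannian, read backwards. -/
theorem grassEmb_of_isomorphism (hQ : IsHyperbolicForm Q n) (h2 : 2 ≤ l) (hlm : l + 1 ≤ m)
    {S : Set (PointD Q n)} (hS : (geomD Q n).IsSubspace S)
    (e : S ≃ {B : Submodule F (Fin (m + 1) → F) // finrank F B = l})
    (he : ∀ L : Set S, L ∈ ((geomD Q n).induced S).lines ↔ e '' L ∈ (geomA F m l).lines)
    {f : Submodule F (Fin (m + 1) → F) → Submodule F W}
    (hf : ∀ (B : Submodule F (Fin (m + 1) → F)) (hB : finrank F B = l),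
      f B = (e.symm ⟨B, hB⟩).1.1) : GrassEmb Q n l f := by
  have := hQ.finiteDimensional
  have hts : ∀ B : Submodule F (Fin (m + 1) → F), finrank F B = l → IsTotSingular Q (f B) :=
    fun B hB => hf B hB ▸ (e.symm ⟨B, hB⟩).1.2.1
  have hdim : ∀ B : Submodule F (Fin (m + 1) → F), finrank F B = l → finrank F (f B) + 2 = n :=
    fun B hB => hf B hB ▸ (e.symm ⟨B, hB⟩).1.2.2
  have hinj : ∀ B B' : Submodule F (Fin (m + 1) → F), finrank F B = l → finrank F B' = l →
      f B = f B' → B = B' := by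
    intro B B' hB hB' h
    rw [hf B hB, hf B' hB'] at h
    have := e.symm.injective (Subtype.ext (Subtype.ext h))
    exact congrArg Subtype.val this
  have key : ∀ B B' : Submodule F (Fin (m + 1) → F), finrank F B = l → finrank F B' = l →
      finrank F (B ⊓ B' : Submodule F (Fin (m + 1) → F)) + 1 = l →
      (IsTotSingular Q (f B ⊔ f B') ∧ finrank F (f B ⊔ f B' : Submodule F W) + 1 = n) ∧
      ∀ P : Submodule F W, finrank F P + 2 = n → f B ⊓ f B' ≤ P → P ≤ f B ⊔ f B' →
        ∃ D : Submodule F (Fin (m + 1) → F), finrank F D = l ∧ B ⊓ B' ≤ D ∧ D ≤ B ⊔ B' ∧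
          f D = P := by
    intro B B' hB hB' hadj
    have hs := finrank_sup_add_inf B B'
    -- The pencil of `B` and `B'` corresponds to a line of the polar geometry; two distinct points
    -- on it already determine `L₀` and `L₁ ⊓ L₂`.
    set L : Set {B : Submodule F (Fin (m + 1) → F) // finrank F B = l} :=
      {D | B ⊓ B' ≤ D.1 ∧ D.1 ≤ B ⊔ B'} with hL
    have hLl : L ∈ (geomA F m l).lines :=
      ⟨B ⊓ B', B ⊔ B', inf_le_left.trans le_sup_left, hadj, by omega, rfl⟩
    have hL' := (he (e.symm '' L)).2 (by rwa [Equiv.image_symm_image])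
    obtain ⟨L₀, L₁, L₂, t1, e1, t2, e2, e3, e0, -, -, hLeq⟩ := hL'
    have hmem : ∀ (D : Submodule F (Fin (m + 1) → F)) (hD : finrank F D = l), B ⊓ B' ≤ D →
        D ≤ B ⊔ B' → L₀ ≤ f D ∧ f D ≤ L₁ ⊓ L₂ := by
      intro D hD h1 h2
      have : (e.symm ⟨D, hD⟩).1 ∈ Subtype.val '' (e.symm '' L) :=
        ⟨_, ⟨⟨D, hD⟩, ⟨h1, h2⟩, rfl⟩, rfl⟩
      rw [hLeq] at this
      rw [hf D hD]
      exact this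
    have hm := hmem B hB inf_le_left le_sup_left
    have hm' := hmem B' hB' inf_le_right le_sup_right
    have hne : f B ≠ f B' := fun h => by
      rw [hinj B B' hB hB' h, inf_idem] at hadj
      omega
    have dB := hdim B hB
    have dB' := hdim B' hB'
    have b1 := finrank_inf_lt hne (by omega)
    have b2 := finrank_sup_add_inf (f B) (f B')
    have hsup : f B ⊔ f B' = L₁ ⊓ L₂ := sup_eq_of_finrank hm.2 hm'.2 (by omega)
    rw [hsup] at b2
    have hinf : f B ⊓ f B' = L₀ := inf_eq_of_finrank hm.1 hm'.1 (by omega)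
    rw [hsup, hinf]
    refine ⟨⟨t1.mono inf_le_left, e3⟩, fun P hP h1 h2 => ?_⟩
    have : (⟨P, t1.mono (h2.trans inf_le_left), hP⟩ : PointD Q n) ∈
        Subtype.val '' (e.symm '' L) := by
      rw [hLeq]
      exact ⟨h1, h2⟩
    obtain ⟨_, ⟨D, hD, rfl⟩, hDP⟩ := this
    refine ⟨D.1, D.2, hD.1, hD.2, ?_⟩
    rw [hf D.1 D.2]
    exact congrArg Subtype.val hDP
  refine ⟨h2, ?_, hts, hdim, hinj, fun B B' hB hB' h => (key B B' hB hB' h).1,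
    fun B B' hB hB' ht hd => ?_, fun B B' hB hB' h => (key B B' hB hB' h).2⟩
  · simp only [finrank_fintype_fun_eq_card, Fintype.card_fin]
    omega
  -- Reflection of adjacency: the span of the two images is an intersection of two maximal spaces,
  -- so they lie on a line. That line meets `S` twice, hence lies in `S` and corresponds to a pencil
  -- containing `B` and `B'`.
  · obtain ⟨L₁, L₂, t1, e1, t2, e2, hL⟩ := hQ.exists_inf_eq ht hd
    have dB := hdim B hB
    have dB' := hdim B' hB'
    have b2 := finrank_sup_add_inf (f B) (f B')
    set L : Set (PointD Q n) := {P | f B ⊓ f B' ≤ P.1 ∧ P.1 ≤ L₁ ⊓ L₂} with hLdef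
    have hle : f B ⊓ f B' ≤ L₁ ⊓ L₂ := hL ▸ inf_le_left.trans le_sup_left
    have hLl : L ∈ (geomD Q n).lines := ⟨f B ⊓ f B', L₁, L₂, t1, e1, t2, e2, by rw [hL]; exact hd,
      by omega, hle.trans inf_le_left, hle.trans inf_le_right, rfl⟩
    have hBL : (e.symm ⟨B, hB⟩).1 ∈ L := by
      change _ ≤ (e.symm ⟨B, hB⟩).1.1 ∧ (e.symm ⟨B, hB⟩).1.1 ≤ _
      rw [← hf B hB, hL]
      exact ⟨inf_le_left, le_sup_left⟩
    have hBL' : (e.symm ⟨B', hB'⟩).1 ∈ L := by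
      change _ ≤ (e.symm ⟨B', hB'⟩).1.1 ∧ (e.symm ⟨B', hB'⟩).1.1 ≤ _
      rw [← hf B' hB', hL]
      exact ⟨inf_le_right, le_sup_right⟩
    have hne : B ≠ B' := by
      rintro rfl
      rw [sup_idem] at hd
      omega
    have hLS : L ⊆ S := hS L hLl ⟨_, ⟨hBL, (e.symm ⟨B, hB⟩).2⟩, _, ⟨hBL', (e.symm ⟨B', hB'⟩).2⟩,
      fun h => hne (congrArg Subtype.val (e.symm.injective (Subtype.ext h)))⟩
    have himg : (Subtype.val '' (Subtype.val ⁻¹' L : Set S) : Set (PointD Q n)) = L := by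
      rw [Subtype.image_preimage_coe]
      exact Set.inter_eq_right.2 hLS
    obtain ⟨A, C, hAC, dA, dC, heq⟩ := (he (Subtype.val ⁻¹' L)).1 (by
      change Subtype.val '' (Subtype.val ⁻¹' L : Set S) ∈ (geomD Q n).lines
      rwa [himg])
    have hmemA : ∀ (D : Submodule F (Fin (m + 1) → F)) (hD : finrank F D = l),
        (e.symm ⟨D, hD⟩).1 ∈ L → A ≤ D := by
      intro D hD h
      have : (⟨D, hD⟩ : {B : Submodule F (Fin (m + 1) → F) // finrank F B = l}) ∈
          e '' (Subtype.val ⁻¹' L) := ⟨_, h, e.apply_symm_apply _⟩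
      rw [heq] at this
      exact this.1
    have hle := Submodule.finrank_mono (le_inf (hmemA B hB hBL) (hmemA B' hB' hBL'))
    have := finrank_inf_lt hne (by omega)
    omega

theorem incidentD_iff_le [FiniteDimensional F W] {P X : Submodule F W} (hP : finrank F P + 2 = n)
    (hX : finrank F X + 2 ≤ n) : IncidentD n P X ↔ X ≤ P := by
  refine ⟨?_, fun h => Or.inr (Or.inl h)⟩
  rintro (h | h | h)
  · exact (Submodule.eq_of_le_of_finrank_le h (by omega)).ge
  · exact h
  · omega

theorem incidentD_iff_le_maximal [FiniteDimensional F W] {P M : Submodule F W}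
    (hP : finrank F P + 2 = n) (hM : finrank F M = n) : IncidentD n P M ↔ P ≤ M := by
  refine ⟨?_, Or.inl⟩
  rintro (h | h | h)
  · exact h
  · have := Submodule.finrank_mono h
    omega
  · omega

/-- The set of points above a totally singular subspace is parabolic. -/
theorem isParabolicD_of_le [FiniteDimensional F W] {X : Submodule F W} (hX : IsTotSingular Q X)
    (dX : finrank F X + 2 ≤ n) : IsParabolicD Q n {P | X ≤ P.1} := by
  -- The zero space is not an object of the building, so for `X = ⊥` the flag has to be empty.
  refine ⟨{Z | Z = X ∧ 1 ≤ finrank F X}, ⟨?_, ?_⟩, ?_⟩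
  · rintro _ ⟨rfl, h⟩
    exact ⟨hX, Or.inl ⟨h, dX⟩⟩
  · rintro _ ⟨rfl, h⟩ _ ⟨rfl, h'⟩ hne
    exact (hne rfl).elim
  · ext P
    refine ⟨?_, fun h => ?_⟩
    · rintro hXP _ ⟨rfl, -⟩
      exact (incidentD_iff_le P.2.2 dX).2 hXP
    · rcases Nat.eq_zero_or_pos (finrank F X) with h0 | h0
      · rw [Submodule.finrank_eq_zero] at h0
        subst h0
        exact (bot_le : (⊥ : Submodule F W) ≤ P.1)
      · exact (incidentD_iff_le P.2.2 dX).1 (h X ⟨rfl, h0⟩)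

/-- The set of points in an interval below a maximal totally singular subspace is parabolic. -/
theorem isParabolicD_of_interval [FiniteDimensional F W] {X M : Submodule F W} (hXM : X ≤ M)
    (dX : finrank F X + 2 ≤ n) (hM : IsTotSingular Q M) (dM : finrank F M = n) :
    IsParabolicD Q n {P | X ≤ P.1 ∧ P.1 ≤ M} := by
  -- Again `X` is dropped from the flag when it is zero, leaving only `M`.
  refine ⟨{Z | Z = X ∧ 1 ≤ finrank F X ∨ Z = M}, ⟨?_, ?_⟩, ?_⟩
  · rintro _ (⟨rfl, h⟩ | rfl)
    · exact ⟨hM.mono hXM, Or.inl ⟨h, dX⟩⟩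
    · exact ⟨hM, Or.inr dM⟩
  · rintro _ (⟨rfl, h⟩ | rfl) _ (⟨rfl, h'⟩ | rfl) hne
    · exact (hne rfl).elim
    · exact Or.inl hXM
    · exact Or.inr (Or.inl hXM)
    · exact (hne rfl).elim
  · ext P
    refine ⟨?_, fun h => ⟨?_, (incidentD_iff_le_maximal P.2.2 dM).1 (h M (Or.inr rfl))⟩⟩
    · rintro ⟨hXP, hPM⟩ _ (⟨rfl, -⟩ | rfl)
      · exact (incidentD_iff_le P.2.2 dX).2 hXP
      · exact (incidentD_iff_le_maximal P.2.2 dM).2 hPM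
    · rcases Nat.eq_zero_or_pos (finrank F X) with h0 | h0
      · rw [Submodule.finrank_eq_zero] at h0
        subst h0
        exact (bot_le : (⊥ : Submodule F W) ≤ P.1)
      · exact (incidentD_iff_le P.2.2 dX).1 (h X (Or.inl ⟨rfl, h0⟩))

end Isomorphism

/-! ### The main theorem -/

theorem mainTheorem2 {F : Type u} [Field F] {W : Type v} [AddCommGroup W] [Module F W]
    (n : ℕ) (hn : 3 ≤ n) (Q : QuadraticForm F W) (hQ : IsHyperbolicForm Q n)
    (m l : ℕ) (hl : 2 ≤ min l (m + 1 - l))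
    (S : Set (PointD Q n)) (hS : (geomD Q n).IsSubspace S)
    (hiso : ((geomD Q n).induced S).Isomorphic (geomA F m l)) :
    IsParabolicD Q n S ∧
      (l = 2 ∨ l + 1 = m) ∧
      (4 ≤ m → ∃ M : Submodule F W, IsTotSingular Q M ∧ finrank F M = n ∧ ∀ P ∈ S, P.1 ≤ M) := by
  classical
  have := hQ.finiteDimensional
  obtain ⟨e, he⟩ := hiso
  have h2 : 2 ≤ l := hl.trans (min_le_left _ _)
  have hlm : 2 ≤ m + 1 - l := hl.trans (min_le_right _ _)
  set f : Submodule F (Fin (m + 1) → F) → Submodule F W :=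
    fun B => if hB : finrank F B = l then (e.symm ⟨B, hB⟩).1.1 else ⊥ with hfdef
  have hf : ∀ (B : Submodule F (Fin (m + 1) → F)) (hB : finrank F B = l),
      f B = (e.symm ⟨B, hB⟩).1.1 := fun B hB => dif_pos hB
  have hrange : ∀ P : PointD Q n,
      P ∈ S ↔ ∃ B : Submodule F (Fin (m + 1) → F), finrank F B = l ∧ f B = P.1 := by
    intro P
    refine ⟨fun hP => ⟨(e ⟨P, hP⟩).1, (e ⟨P, hP⟩).2, ?_⟩, ?_⟩
    · rw [hf _ (e ⟨P, hP⟩).2, Subtype.coe_eta, Equiv.symm_apply_apply]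
    · rintro ⟨B, hB, h⟩
      rw [hf B hB] at h
      exact Subtype.ext h ▸ (e.symm ⟨B, hB⟩).2
  have hE := grassEmb_of_isomorphism hQ h2 (by omega) hS e he hf
  have hV : finrank F (Fin (m + 1) → F) = m + 1 := by simp
  obtain ⟨hlor, ⟨X, M, hM, dM, hXM, dX, h⟩ | ⟨hfour, X, hX, dX, h⟩⟩ := hE.classification hQ
  · have hSeq : S = {P | X ≤ P.1 ∧ P.1 ≤ M} := by
      ext P
      exact (hrange P).trans (h P.1 P.2.2)
    refine ⟨hSeq ▸ isParabolicD_of_interval hXM dX hM dM, by omega, fun _ => ⟨M, hM, dM, ?_⟩⟩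
    intro P hP
    rw [hSeq] at hP
    exact hP.2
  · have hSeq : S = {P | X ≤ P.1} := by
      ext P
      exact (hrange P).trans (h P.1 P.2.1 P.2.2)
    -- Here `m + 1 = 4`, so the assumption `4 ≤ m` of the last claim is contradictory.
    exact ⟨hSeq ▸ isParabolicD_of_le hX (by omega), by omega, fun _ => by omega⟩
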